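/- Let $X$ be a closed surface (a compact Hausdorff $2$-manifold without boundary, connected or not) with a finite simplicial triangulation $T=\{V,E,F\}$ with vertices $V$, edges $E$ and triangles $F$, and let $\Phi:E\to[0,\pi/2]$ be a weight. A circle packing metric is a function $r:V\to(0,\infty)$. It gives each edge $\{i,j\}\in E$ the length $l_{ij}>0$ with $$\cosh l_{ij}=\cosh r_i\cosh r_j+\sinh r_i\sinh r_j\cos\Phi_{ij},$$ so that each $\{i,j,k\}\in F$ becomes a hyperbolic triangle; let $\theta_i^{jk}$ be its inner angle at $i$, and put $$K_i=2\pi-\sum_{\{i,j,k\}\in F}\theta_i^{jk},\qquad R_i=\frac{K_i}{4\pi\sinh^2(r_i/2)}.$$ A zero curvature metric is a circle packing metric with $R_i=0$ for all $i\in V$. The combinatorial Ricci flow is the system $\frac{dg_i}{dt}=-R_i\,g_i$, $i\in V$, for a time-dependent circle packing metric $r(t)$, where $g_i=\sinh^2(r_i/2)$. **Theorem.** Let $r(0)$ be a circle packing metric all of whose curvatures are nonpositive: $R_i(0)\le 0$ for every $i\in V$. Then there exists a zero curvature metric. Furthermore, the (unique) solution $r(t)$ of the combinatorial Ricci flow with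 initial metric $r(0)$ exists for all $t\in[0,\infty)$ and converges exponentially fast to a zero curvature metric $r^*$: there are constants $C$ and $c>0$ with $\|r(t)-r^*\|\le C e^{-ct}$ for all $t\ge 0$. -/

import Mathlib

namespace CirclePacking

/-- The geometric realization of a finite abstract simplicial complex `K` on the vertex set `V`:
the points of the standard simplex (barycentric coordinates indexed by `V`) whose support
is a simplex of `K`, with the topology of a subspace of `ℝ^V`. -/
def realization {V : Type*} [Fintype V] (K : AbstractSimplicialComplex V) : Set (V → ℝ) :=
  {x | x ∈ stdSimplex ℝ V ∧ ∃ s ∈ K.faces, ∀ v, v ∈ s ↔ x v ≠ 0}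

/-- A triangulation `{V, E, F}` of the space `X` with (finite) vertex set `V`: a simplicial
complex of dimension at most two on `V` together with a homeomorphism of its geometric
realization onto `X`. -/
structure Triangulation (V : Type*) [Fintype V] (X : Type*) [TopologicalSpace X] where
  /-- The underlying simplicial complex; its vertices are all the elements of `V`. -/
  complex : AbstractSimplicialComplex V
  /-- There are only vertices, edges and triangles. -/
  card_le_three : ∀ s ∈ complex.faces, s.card ≤ 3
  /-- The identification of the geometric realization with `X`. -/
  homeo : realization complex ≃ₜ X

variable {V : Type*} [Fintype V] {X : Type*} [TopologicalSpace X]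

/-- The set `E` of edges, each given by its two end points. -/
def Triangulation.edges (T : Triangulation V X) : Set (Finset V) :=
  {e | e ∈ T.complex.faces ∧ e.card = 2}

/-- The set `F` of faces (triangles), each given by its three vertices. -/
def Triangulation.triangles (T : Triangulation V X) : Set (Finset V) :=
  {f | f ∈ T.complex.faces ∧ f.card = 3}

/-- `Φ : E → [0, π/2]` is a weight on the triangulation. (Values of `Φ` on sets that are not edges
of `T` play no role.) -/
def IsWeight (T : Triangulation V X) (Φ : Finset V → ℝ) : Prop :=
  ∀ e ∈ T.edges, Φ e ∈ Set.Icc 0 (Real.pi / 2)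

/-- A circle packing metric: a positive function on the vertices. -/
def IsMetric (r : V → ℝ) : Prop :=
  ∀ i, 0 < r i

open Classical in
/-- The hyperbolic length `l_{ij}` of the edge `{i, j}`:
`cosh l_{ij} = cosh r_i cosh r_j + sinh r_i sinh r_j cos Φ_{ij}`. -/
noncomputable def edgeLength (Φ : Finset V → ℝ) (r : V → ℝ) (i j : V) : ℝ :=
  Real.arcosh (Real.cosh (r i) * Real.cosh (r j)
    + Real.sinh (r i) * Real.sinh (r j) * Real.cos (Φ {i, j}))

/-- The inner angle `θ_i^{jk}` at the vertex `i` of the hyperbolic triangle `v_i v_j v_k` with side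
lengths `l_{ij}, l_{ik}, l_{jk}`, by the hyperbolic cosine law. -/
noncomputable def innerAngle (Φ : Finset V → ℝ) (r : V → ℝ) (i j k : V) : ℝ :=
  Real.arccos
    ((Real.cosh (edgeLength Φ r i j) * Real.cosh (edgeLength Φ r i k)
        - Real.cosh (edgeLength Φ r j k))
      / (Real.sinh (edgeLength Φ r i j) * Real.sinh (edgeLength Φ r i k)))

open Classical in
/-- The classical combinatorial Gauss curvature `K_i = 2π - ∑_{{i,j,k} ∈ F} θ_i^{jk}`.
The sum below runs over ordered pairs `(j, k)`, so that it meets each triangle at `i` twice,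
with the same angle `θ_i^{jk} = θ_i^{kj}`; hence the factor `1/2`. -/
noncomputable def classicalCurvature (T : Triangulation V X) (Φ : Finset V → ℝ) (r : V → ℝ)
    (i : V) : ℝ :=
  2 * Real.pi
    - (1 / 2 : ℝ) * ∑ j : V, ∑ k : V,
        if ({i, j, k} : Finset V) ∈ T.triangles then innerAngle Φ r i j k else 0

/-- The modified combinatorial Gauss curvature `R_i = K_i / (4π sinh² (r_i / 2))`. -/
noncomputable def curvature (T : Triangulation V X) (Φ : Finset V → ℝ) (r : V → ℝ) (i : V) : ℝ :=
  classicalCurvature T Φ r i / (4 * Real.pi * Real.sinh (r i / 2) ^ 2)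

/-- A zero curvature metric: a circle packing metric all of whose curvatures vanish. -/
def IsZeroCurvatureMetric (T : Triangulation V X) (Φ : Finset V → ℝ) (r : V → ℝ) : Prop :=
  IsMetric r ∧ ∀ i, curvature T Φ r i = 0

/-- `r` is a solution on the time interval `J` of the combinatorial Ricci flow
`dg_i/dt = -R_i g_i`, `g_i = sinh² (r_i / 2)`, with initial metric `r₀` at time `0`.
(Derivatives at an end point of `J` that belongs to `J` are one-sided.) -/
def IsRicciFlow (T : Triangulation V X) (Φ : Finset V → ℝ) (r₀ : V → ℝ) (J : Set ℝ)
    (r : ℝ → V → ℝ) : Prop :=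
  r 0 = r₀ ∧
  ∀ t ∈ J, IsMetric (r t) ∧
    ∀ i, HasDerivWithinAt (fun s => Real.sinh (r s i / 2) ^ 2)
      (-(curvature T Φ (r t) i) * Real.sinh (r t i / 2) ^ 2) J t

end CirclePacking

/-!
The flow is studied in the coordinates `g = sinh² (r / 2)`, in which it reads
`dg i / dt = F i g = -K i / (4π)` (`flowField`). Each angle `θ_i` of a triangle is a nondecreasing
function of the radii at the other two vertices (`angle_mono`, which uses that the weights are at
most `π / 2`), so the vector field `F` is quasimonotone: `F i` is nondecreasing in all `g j` with
`j ≠ i`. For such fields subsolutions stay below supersolutions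
(`QuasimonotoneOn.le_of_subsolution_of_supersolution`), and everything follows from comparison:

* The curvatures of the initial metric are nonpositive, so the constant initial metric is a
  subsolution. Hence the solution stays above it and is nondecreasing in time.
* The angles at a vertex tend to zero when the radius there tends to infinity, uniformly in the
  other radii (`exists_forall_angle_le`). So `F i ≤ 0` when `g i` is large, a large constant is a
  supersolution, and the solution stays bounded (`QuasimonotoneOn.exists_monotone_solution`). It
  exists for all time and increases to a limit, which is an equilibrium of `F`, that is, a zero
  curvature metric.
* When all `tanh (r / 2)` are scaled down simultaneously, all angles increase strictly to first
  order (`exists_hasDerivAt_angle_pos`). In the coordinates `u = log tanh (r / 2)` the Jacobian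
  matrix of the angles is symmetric (`angle_deriv_symm`), so the derivative of `θ_i` under scaling
  is the derivative of the angle sum of the triangle with respect to `u i`, that is, minus the
  derivative of the area. Up to positive factors the latter is a polynomial in the `cosh r` and
  `sinh r` with nonnegative coefficients (`area_deriv_numerator_pos`). Since every vertex lies in a
  triangle at an equilibrium `y`, the components of `F (y - s • d)` grow at least linearly in
  `s ≥ 0` for a positive direction `d`. The curves `y - ε exp (-k t) d` are therefore subsolutions,
  and they force the solution to approach `y` exponentially fast
  (`QuasimonotoneOn.exists_solution_tendsto_exponentially`).
-/

namespace CirclePacking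

open Set Filter Topology
open scoped NNReal

/-! ### Comparison and global existence for ordinary differential equations -/

theorem hasDerivAt_max_zero_sq (x : ℝ) :
    HasDerivAt (fun y : ℝ => max y 0 ^ 2) (2 * max x 0) x := by
  rcases lt_trichotomy x 0 with hx | rfl | hx
  · have h : (fun y : ℝ => max y 0 ^ 2) =ᶠ[𝓝 x] fun _ => 0 := by
      filter_upwards [Iio_mem_nhds hx] with y hy
      simp [(mem_Iio.1 hy).le]
    simpa [max_eq_right hx.le] using (hasDerivAt_const x (0 : ℝ)).congr_of_eventuallyEq h
  · have h : HasDerivAt (fun y : ℝ => max y 0 ^ 2) 0 0 := by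
      refine HasDerivAt.of_isLittleO ?_
      have h1 : (fun y : ℝ => y ^ 2) =o[𝓝 0] fun y : ℝ => y := by
        simpa using Asymptotics.isLittleO_pow_pow (𝕜 := ℝ) (m := 1) (n := 2) one_lt_two
      refine (Asymptotics.IsBigO.of_bound 1 (Eventually.of_forall fun y => ?_)).trans_isLittleO
        (by simpa using h1)
      have h2 : |max y 0| ≤ |y| := by
        rcases le_total y 0 with h | h <;> simp [h]
      have h3 := pow_le_pow_left₀ (abs_nonneg _) h2 2
      simpa using h3
    simpa using h
  · have h : (fun y : ℝ => max y 0 ^ 2) =ᶠ[𝓝 x] fun y => y ^ 2 := by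
      filter_upwards [Ioi_mem_nhds hx] with y hy
      rw [max_eq_left (le_of_lt hy)]
    have h' := (hasDerivAt_pow 2 x).congr_of_eventuallyEq h
    simpa [max_eq_left hx.le] using h'

/-- A vector field is *quasimonotone* on `S` if each component is nondecreasing in all the other
coordinates. -/
def QuasimonotoneOn {V : Type*} (F : (V → ℝ) → V → ℝ) (S : Set (V → ℝ)) : Prop :=
  ∀ x ∈ S, ∀ y ∈ S, x ≤ y → ∀ i, x i = y i → F x i ≤ F y i

/-- The Müller–Kamke comparison principle: for a quasimonotone Lipschitz vector field, a subsolution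
that starts below a supersolution stays below it. The squared size of the positive part of the
difference `v - w` satisfies a linear differential inequality. -/
theorem QuasimonotoneOn.le_of_subsolution_of_supersolution {V : Type*} [Fintype V]
    {F : (V → ℝ) → V → ℝ} {S : Set (V → ℝ)} {K : ℝ≥0} (hq : QuasimonotoneOn F S)
    (hF : LipschitzOnWith K F S) (hS : ∀ x ∈ S, ∀ y ∈ S, x ⊔ y ∈ S)
    {v w v' w' : ℝ → V → ℝ} {a b : ℝ}
    (hv : ∀ t ∈ Icc a b, HasDerivWithinAt v (v' t) (Icc a b) t)
    (hw : ∀ t ∈ Icc a b, HasDerivWithinAt w (w' t) (Icc a b) t)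
    (hvS : ∀ t ∈ Icc a b, v t ∈ S) (hwS : ∀ t ∈ Icc a b, w t ∈ S)
    (hv' : ∀ t ∈ Icc a b, v' t ≤ F (v t)) (hw' : ∀ t ∈ Icc a b, F (w t) ≤ w' t)
    (h0 : v a ≤ w a) : ∀ t ∈ Icc a b, v t ≤ w t := by
  set m : ℝ → V → ℝ := fun t i => max (v t i - w t i) 0 with hm
  set φ : ℝ → ℝ := fun t => ∑ i, m t i ^ 2 with hφ
  set C : ℝ := 2 * (Fintype.card V * K) with hC
  have hm0 : ∀ t i, 0 ≤ m t i := fun t i => le_max_right _ _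
  have hφ0 : ∀ t, 0 ≤ φ t := fun t => Finset.sum_nonneg fun i _ => sq_nonneg _
  have hφd : ∀ t ∈ Icc a b,
      HasDerivWithinAt φ (∑ i, 2 * m t i * (v' t i - w' t i)) (Icc a b) t := by
    intro t ht
    refine HasDerivWithinAt.fun_sum fun i _ => ?_
    have h1 := (hasDerivWithinAt_pi.1 (hv t ht) i).sub (hasDerivWithinAt_pi.1 (hw t ht) i)
    exact (hasDerivAt_max_zero_sq (v t i - w t i)).comp_hasDerivWithinAt t h1
  have hnorm : ∀ t, ‖m t‖ ^ 2 ≤ φ t := by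
    intro t
    have : ‖m t‖ ≤ √(φ t) := by
      refine (pi_norm_le_iff_of_nonneg (Real.sqrt_nonneg _)).2 fun i => ?_
      refine Real.abs_le_sqrt ?_
      exact Finset.single_le_sum (f := fun i => m t i ^ 2) (fun i _ => sq_nonneg _)
        (Finset.mem_univ i)
    calc ‖m t‖ ^ 2 ≤ √(φ t) ^ 2 := pow_le_pow_left₀ (norm_nonneg _) this 2
      _ = φ t := Real.sq_sqrt (hφ0 t)
  have hbound : ∀ t ∈ Icc a b, ∑ i, 2 * m t i * (v' t i - w' t i) ≤ C * φ t := by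
    intro t ht
    have key : ∀ i, 2 * m t i * (v' t i - w' t i) ≤ 2 * (K * ‖m t‖ ^ 2) := by
      intro i
      rcases le_total (v t i) (w t i) with h | h
      · have : m t i = 0 := by simp [hm, h]
        rw [this]; simp; positivity
      · have hz := hS _ (hvS t ht) _ (hwS t ht)
        have h1 : F (v t) i ≤ F (v t ⊔ w t) i :=
          hq _ (hvS t ht) _ hz le_sup_left i (by simp [h])
        have h2 : F (v t ⊔ w t) i - F (w t) i ≤ K * ‖m t‖ := by
          have h3 := hF.dist_le_mul _ hz _ (hwS t ht)
          have h4 : (v t ⊔ w t) - w t = m t := by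
            funext j
            rcases le_total (v t j) (w t j) with h | h <;> simp [hm, h]
          rw [dist_eq_norm, dist_eq_norm, h4] at h3
          exact (le_abs_self _).trans ((norm_le_pi_norm (F (v t ⊔ w t) - F (w t)) i).trans h3)
        have h5 : v' t i - w' t i ≤ K * ‖m t‖ := by
          have := hv' t ht i
          have := hw' t ht i
          linarith
        have h6 : m t i ≤ ‖m t‖ := (le_abs_self _).trans (norm_le_pi_norm (m t) i)
        have h7 : 0 ≤ (K : ℝ) * ‖m t‖ := by positivity
        nlinarith [mul_le_mul_of_nonneg_left h5 (hm0 t i), mul_le_mul_of_nonneg_right h6 h7]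
    calc _ ≤ ∑ _i : V, 2 * (K * ‖m t‖ ^ 2) := Finset.sum_le_sum fun i _ => key i
      _ = C * ‖m t‖ ^ 2 := by simp [hC]; ring
      _ ≤ C * φ t := mul_le_mul_of_nonneg_left (hnorm t) (by positivity)
  have hanti : AntitoneOn (fun t => φ t * Real.exp (-C * t)) (Icc a b) := by
    have hd : ∀ t ∈ Icc a b, HasDerivWithinAt (fun t => φ t * Real.exp (-C * t))
        ((∑ i, 2 * m t i * (v' t i - w' t i) - C * φ t) * Real.exp (-C * t)) (Icc a b) t := by
      intro t ht
      have he : HasDerivAt (fun t => Real.exp (-C * t)) (Real.exp (-C * t) * (-C)) t := by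
        simpa using ((hasDerivAt_id t).const_mul (-C)).exp
      refine ((hφd t ht).mul he.hasDerivWithinAt).congr_deriv ?_
      ring
    refine antitoneOn_of_hasDerivWithinAt_nonpos (convex_Icc a b)
      (fun t ht => (hd t ht).continuousWithinAt)
      (fun t ht => (hd t (interior_subset ht)).mono interior_subset) fun t ht => ?_
    exact mul_nonpos_of_nonpos_of_nonneg (sub_nonpos.2 (hbound t (interior_subset ht)))
      (Real.exp_pos _).le
  intro t ht i
  have h1 := hanti (left_mem_Icc.2 (ht.1.trans ht.2)) ht ht.1
  have h2 : φ a = 0 := Finset.sum_eq_zero fun i _ => by simp [hm, h0 i]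
  have h3 : φ t ≤ 0 := by
    simp only [h2, zero_mul] at h1
    exact nonpos_of_mul_nonpos_left h1 (Real.exp_pos _)
  have h4 : m t i ^ 2 ≤ 0 :=
    (Finset.single_le_sum (f := fun i => m t i ^ 2) (fun i _ => sq_nonneg _)
      (Finset.mem_univ i)).trans h3
  have h5 : m t i = 0 := by nlinarith [hm0 t i]
  have h6 : v t i - w t i ≤ 0 := h5 ▸ le_max_left _ _
  linarith

/-- A bounded Lipschitz vector field has a solution on `[0, ∞)` through every point. -/
theorem exists_hasDerivWithinAt_Ici_of_lipschitzWith {E : Type*} [NormedAddCommGroup E]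
    [NormedSpace ℝ E] [CompleteSpace E] {f : E → E} {K L : ℝ≥0} (hf : LipschitzWith K f)
    (hL : ∀ x, ‖f x‖ ≤ L) (x₀ : E) :
    ∃ α : ℝ → E, α 0 = x₀ ∧ ∀ t ∈ Ici (0 : ℝ), HasDerivWithinAt α (f (α t)) (Ici 0) t := by
  have hloc : ∀ n : ℕ, ∃ α : ℝ → E, α 0 = x₀ ∧
      ∀ t ∈ Icc (0 : ℝ) (n + 1), HasDerivWithinAt α (f (α t)) (Icc 0 (n + 1)) t := by
    intro n
    have hn : (0 : ℝ) ≤ n + 1 := by positivity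
    have hpl : IsPicardLindelof (fun _ => f) (⟨0, left_mem_Icc.2 hn⟩ : Icc (0 : ℝ) (n + 1)) x₀
        (L * (n + 1)) 0 L K := by
      refine .of_time_independent (fun x _ => hL x) hf.lipschitzOnWith ?_
      simp [hn]
    exact hpl.exists_eq_forall_mem_Icc_hasDerivWithinAt₀
  choose α hα0 hα using hloc
  have hright : ∀ (n : ℕ) (t : ℝ), t ∈ Ico (0 : ℝ) (n + 1) →
      HasDerivWithinAt (α n) (f (α n t)) (Ici t) t := by
    intro n t ht
    have h1 := (hα n t (Ico_subset_Icc_self ht)).mono (Icc_subset_Icc_left ht.1)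
    exact h1.mono_of_mem_nhdsWithin (Icc_mem_nhdsGE ht.2)
  have hagree : ∀ (n m : ℕ), n ≤ m → EqOn (α n) (α m) (Icc 0 (n + 1)) := by
    intro n m hnm
    have hnm' : (n : ℝ) + 1 ≤ m + 1 := by gcongr
    refine ODE_solution_unique (v := fun _ => f) (K := K) (fun _ => hf)
      (fun t ht => (hα n t ht).continuousWithinAt) (hright n)
      (fun t ht => ((hα m t ⟨ht.1, ht.2.trans hnm'⟩).mono
        (Icc_subset_Icc_right hnm')).continuousWithinAt)
      (fun t ht => hright m t ⟨ht.1, ht.2.trans_le hnm'⟩) (by rw [hα0, hα0])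
  refine ⟨fun t => α ⌊t⌋₊ t, by simp [hα0], fun t ht => ?_⟩
  -- Near `t` all the local solutions involved agree with the one on `[0, ⌊t⌋ + 2]`.
  set N := ⌊t⌋₊ + 1 with hN
  have htN : t < N + 1 := by
    have := Nat.lt_floor_add_one t
    rw [hN]; push_cast; linarith
  have heq : ∀ s ∈ Ici (0 : ℝ), s < N + 1 → α ⌊s⌋₊ s = α N s := by
    intro s hs hsN
    refine hagree ⌊s⌋₊ N ?_ ⟨hs, (Nat.lt_floor_add_one s).le⟩
    have : ⌊s⌋₊ < N + 1 := (Nat.floor_lt hs).2 (by push_cast; exact hsN)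
    omega
  have h1 : HasDerivWithinAt (α N) (f (α N t)) (Ici 0) t := by
    refine (hα N t ⟨ht, htN.le⟩).mono_of_mem_nhdsWithin ?_
    rw [← Ici_inter_Iic]
    exact inter_mem self_mem_nhdsWithin (mem_nhdsWithin_of_mem_nhds (Iic_mem_nhds htN))
  simp only [heq t ht htN]
  refine h1.congr_of_eventuallyEq ?_ (heq t ht htN)
  filter_upwards [self_mem_nhdsWithin, mem_nhdsWithin_of_mem_nhds (Iio_mem_nhds htN)] with s hs hs'
  exact heq s hs hs'

/-! ### Convergence of increasing solutions of quasimonotone systems -/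

theorem QuasimonotoneOn.comp_clamp {V : Type*} {F : (V → ℝ) → V → ℝ} {lo hi : V → ℝ}
    (hq : QuasimonotoneOn F (Icc lo hi)) (hle : lo ≤ hi) :
    QuasimonotoneOn (fun x => F (lo ⊔ hi ⊓ x)) univ := by
  intro x _ y _ hxy i hi'
  refine hq _ ⟨le_sup_left, sup_le hle inf_le_left⟩ _ ⟨le_sup_left, sup_le hle inf_le_left⟩
    (sup_le_sup_left (inf_le_inf_left _ hxy) _) i ?_
  simp [hi']

theorem lipschitzWith_clamp {V : Type*} [Fintype V] (lo hi : V → ℝ) :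
    LipschitzWith 1 (fun x : V → ℝ => lo ⊔ hi ⊓ x) := by
  refine LipschitzWith.of_dist_le_mul fun x y => ?_
  rw [NNReal.coe_one, one_mul]
  refine (dist_pi_le_iff dist_nonneg).2 fun i => le_trans ?_ (dist_le_pi_dist x y i)
  rw [Real.dist_eq, Real.dist_eq]
  calc |max (lo i) (min (hi i) (x i)) - max (lo i) (min (hi i) (y i))|
      ≤ |min (hi i) (x i) - min (hi i) (y i)| := by
        simpa [max_comm] using abs_max_sub_max_le_abs (min (hi i) (x i)) (min (hi i) (y i)) (lo i)
    _ ≤ |x i - y i| := by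
        simpa [min_comm] using abs_min_sub_min_le_max (x i) (hi i) (y i) (hi i)

/-- If a Lipschitz quasimonotone vector field on a box is nonnegative at a point `x₀` of the box
and nonpositive at its upper corner, then the solution starting at `x₀` stays in the box for all
time and is nondecreasing. The vector field is extended to the whole space by precomposition with
the nearest-point projection to the box, which keeps it quasimonotone. -/
theorem QuasimonotoneOn.exists_monotone_solution {V : Type*} [Fintype V]
    {F : (V → ℝ) → V → ℝ} {lo hi x₀ : V → ℝ} {K : ℝ≥0} (hq : QuasimonotoneOn F (Icc lo hi))
    (hF : LipschitzOnWith K F (Icc lo hi)) (hx₀ : x₀ ∈ Icc lo hi) (h0 : 0 ≤ F x₀) (hhi : F hi ≤ 0) :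
    ∃ x : ℝ → V → ℝ, x 0 = x₀ ∧
      (∀ t ∈ Ici (0 : ℝ), HasDerivWithinAt x (F (x t)) (Ici 0) t ∧ x t ∈ Icc x₀ hi) ∧
      MonotoneOn x (Ici 0) := by
  have hle : lo ≤ hi := hx₀.1.trans hx₀.2
  set G : (V → ℝ) → V → ℝ := fun x => F (lo ⊔ hi ⊓ x) with hG
  have hclamp : ∀ x : V → ℝ, lo ⊔ hi ⊓ x ∈ Icc lo hi := fun x =>
    ⟨le_sup_left, sup_le hle inf_le_left⟩
  have hGF : ∀ x ∈ Icc lo hi, G x = F x := fun x hx => by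
    rw [hG]; simp only [inf_eq_right.2 hx.2, sup_eq_right.2 hx.1]
  have hGq : QuasimonotoneOn G univ := hq.comp_clamp hle
  have hGlip : LipschitzWith K G := by
    refine LipschitzWith.of_dist_le_mul fun x y => ?_
    refine (hF.dist_le_mul _ (hclamp x) _ (hclamp y)).trans ?_
    have := (lipschitzWith_clamp lo hi).dist_le_mul x y
    rw [NNReal.coe_one, one_mul] at this
    exact mul_le_mul_of_nonneg_left this K.2
  obtain ⟨L, hL⟩ : ∃ L : ℝ≥0, ∀ x, ‖G x‖ ≤ L := by
    obtain ⟨L, hL⟩ := isCompact_Icc.exists_bound_of_continuousOn hF.continuousOn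
    exact ⟨L.toNNReal, fun x => (hL _ (hclamp x)).trans (Real.le_coe_toNNReal L)⟩
  obtain ⟨x, hx0, hx⟩ := exists_hasDerivWithinAt_Ici_of_lipschitzWith hGlip hL x₀
  have hcmp : ∀ {v w v' w' : ℝ → V → ℝ}, (∀ t ∈ Ici (0 : ℝ), HasDerivWithinAt v (v' t) (Ici 0) t) →
      (∀ t ∈ Ici (0 : ℝ), HasDerivWithinAt w (w' t) (Ici 0) t) →
      (∀ t, v' t ≤ G (v t)) → (∀ t, G (w t) ≤ w' t) → v 0 ≤ w 0 →
      ∀ t, 0 ≤ t → v t ≤ w t := by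
    intro v w v' w' hv hw hv' hw' h t ht
    exact hGq.le_of_subsolution_of_supersolution (hGlip.lipschitzOnWith (s := univ))
      (fun _ _ _ _ => mem_univ _)
      (fun s hs => (hv s hs.1).mono Icc_subset_Ici_self)
      (fun s hs => (hw s hs.1).mono Icc_subset_Ici_self) (fun _ _ => mem_univ _)
      (fun _ _ => mem_univ _) (fun s _ => hv' s) (fun s _ => hw' s) h t (right_mem_Icc.2 ht)
  have hlow : ∀ t, 0 ≤ t → x₀ ≤ x t := by
    refine hcmp (v := fun _ => x₀) (v' := fun _ => 0) (fun t _ => hasDerivWithinAt_const t _ _) hx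
      (fun t => ?_) (fun t => le_rfl) hx0.ge
    rw [hGF _ hx₀]; exact h0
  have hupp : ∀ t, 0 ≤ t → x t ≤ hi := by
    refine hcmp (w := fun _ => hi) (w' := fun _ => 0) hx (fun t _ => hasDerivWithinAt_const t _ _)
      (fun t => le_rfl) (fun t => ?_) (hx0.le.trans hx₀.2)
    rw [hGF _ ⟨hle, le_rfl⟩]; exact hhi
  refine ⟨x, hx0, fun t ht => ⟨?_, hlow t ht, hupp t ht⟩, ?_⟩
  · rw [← hGF (x t) ⟨hx₀.1.trans (hlow t ht), hupp t ht⟩]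
    exact hx t ht
  · -- The translate of a solution by `h ≥ 0` is a solution that starts above `x₀`.
    intro s hs t _ hst
    have h1 : ∀ r ∈ Ici (0 : ℝ), HasDerivWithinAt (fun r => x (r + (t - s))) (G (x (r + (t - s))))
        (Ici 0) r := by
      intro r hr
      have hr' : r + (t - s) ∈ Ici (0 : ℝ) := add_nonneg hr (sub_nonneg.2 hst)
      have := (hx _ hr').scomp r ((hasDerivWithinAt_id r (Ici 0)).add_const (t - s))
        (fun u hu => add_nonneg hu (sub_nonneg.2 hst))
      simpa [Function.comp_def] using this
    have h2 := hcmp hx h1 (fun r => le_rfl) (fun r => le_rfl)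
      (by rw [hx0]; exact hlow _ (by linarith)) s hs
    simpa using h2

/-- A limit at infinity of a solution of an autonomous differential equation is an equilibrium. -/
theorem eq_zero_of_tendsto_of_hasDerivWithinAt {V : Type*} [Finite V]
    {F : (V → ℝ) → V → ℝ} {S : Set (V → ℝ)} (hF : ContinuousOn F S) {x : ℝ → V → ℝ} {y : V → ℝ}
    (hx : ∀ t ∈ Ici (0 : ℝ), HasDerivWithinAt x (F (x t)) (Ici 0) t)
    (hxS : ∀ t ∈ Ici (0 : ℝ), x t ∈ S)
    (hyS : y ∈ S) (hlim : Tendsto x atTop (𝓝 y)) : F y = 0 := by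
  have := Fintype.ofFinite V
  funext i
  have hlimF : Tendsto (fun t => F (x t) i) atTop (𝓝 (F y i)) := by
    have h1 : Tendsto x atTop (𝓝[S] y) := tendsto_nhdsWithin_iff.2
      ⟨hlim, (eventually_ge_atTop 0).mono fun t ht => hxS t ht⟩
    exact (tendsto_pi_nhds.1 ((hF y hyS).tendsto.comp h1) i)
  have hd : ∀ t ∈ Ici (0 : ℝ), HasDerivWithinAt (fun t => x t i) (F (x t) i) (Ici 0) t :=
    fun t ht => hasDerivWithinAt_pi.1 (hx t ht) i
  have hmvt : ∀ n : ℕ, ∃ ξ : ℝ, (n : ℝ) < ξ ∧ F (x ξ) i = x (n + 1) i - x n i := by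
    intro n
    have hn : (0 : ℝ) ≤ n := n.cast_nonneg
    obtain ⟨ξ, hξ, h⟩ := exists_hasDerivAt_eq_slope (fun t => x t i) (fun t => F (x t) i)
      (lt_add_one (n : ℝ))
      (fun t ht => ((hd t (hn.trans ht.1)).mono
        (Icc_subset_Ici_self.trans (Ici_subset_Ici.2 hn))).continuousWithinAt)
      (fun t ht => (hd t (hn.trans ht.1.le)).hasDerivAt (Ici_mem_nhds (hn.trans_lt ht.1)))
    exact ⟨ξ, hξ.1, by simpa using h⟩
  choose ξ hξ h using hmvt
  have h1 : Tendsto (fun n : ℕ => F (x (ξ n)) i) atTop (𝓝 (F y i)) :=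
    hlimF.comp (tendsto_atTop_mono (fun n => (hξ n).le) tendsto_natCast_atTop_atTop)
  have h2 : Tendsto (fun n : ℕ => x (n + 1) i - x n i) atTop (𝓝 (y i - y i)) := by
    have h3 := tendsto_pi_nhds.1 hlim i
    have h4 : Tendsto (fun n : ℕ => (n : ℝ) + 1) atTop atTop :=
      tendsto_atTop_add_const_right _ _ tendsto_natCast_atTop_atTop
    exact (h3.comp h4).sub (h3.comp tendsto_natCast_atTop_atTop)
  simp only [h] at h1
  simpa using tendsto_nhds_unique h1 h2

/-- The solution of a quasimonotone system on the positive orthant, starting at a point where the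
vector field is nonnegative, increases to an equilibrium at an exponential rate, provided that large
components do not increase and that each equilibrium `y` can be approached from below along a
positive direction `d` in which the vector field grows at least linearly. The curves
`y - s exp (-k t) d` are then subsolutions. -/
theorem QuasimonotoneOn.exists_solution_tendsto_exponentially {V : Type*} [Fintype V]
    {F : (V → ℝ) → V → ℝ} {x₀ : V → ℝ} {B : ℝ}
    (hq : QuasimonotoneOn F {x | ∀ i, 0 < x i})
    (hF : ∀ lo hi : V → ℝ, (∀ i, 0 < lo i) → ∃ K, LipschitzOnWith K F (Icc lo hi))
    (hB : ∀ x : V → ℝ, (∀ i, 0 < x i) → ∀ i, B ≤ x i → F x i ≤ 0)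
    (hx₀ : ∀ i, 0 < x₀ i) (h0 : 0 ≤ F x₀)
    (hstab : ∀ y : V → ℝ, (∀ i, 0 < y i) → F y = 0 → ∃ d : V → ℝ, (∀ i, 0 < d i) ∧
      ∃ c > 0, ∃ δ > 0, ∀ s ∈ Icc (0 : ℝ) δ, ∀ i, c * s ≤ F (y - s • d) i) :
    ∃ y : V → ℝ, F y = 0 ∧ x₀ ≤ y ∧ ∃ x : ℝ → V → ℝ, x 0 = x₀ ∧
      (∀ t ∈ Ici (0 : ℝ), HasDerivWithinAt x (F (x t)) (Ici 0) t ∧ x t ∈ Icc x₀ y) ∧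
      ∃ C c : ℝ, 0 < c ∧ ∀ t, 0 ≤ t → ‖x t - y‖ ≤ C * Real.exp (-c * t) := by
  set lo : V → ℝ := fun i => x₀ i / 2 with hlo
  set hi : V → ℝ := fun i => max (x₀ i) B with hhi
  have hlo0 : ∀ i, 0 < lo i := fun i => half_pos (hx₀ i)
  have hx₀S : x₀ ∈ Icc lo hi := ⟨fun i => (half_lt_self (hx₀ i)).le, fun i => le_max_left _ _⟩
  have hSpos : Icc lo hi ⊆ {x | ∀ i, 0 < x i} := fun x hx i => (hlo0 i).trans_le (hx.1 i)
  have hqS : QuasimonotoneOn F (Icc lo hi) := fun x hx y hy => hq x (hSpos hx) y (hSpos hy)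
  obtain ⟨K, hK⟩ := hF lo hi hlo0
  obtain ⟨x, hx0, hx, hmono⟩ := hqS.exists_monotone_solution hK hx₀S h0
    (fun i => hB hi (fun j => (hx₀ j).trans_le (le_max_left _ _)) i (le_max_right _ _))
  have hxS : ∀ t ∈ Ici (0 : ℝ), x t ∈ Icc lo hi := fun t ht =>
    ⟨hx₀S.1.trans (hx t ht).2.1, (hx t ht).2.2⟩
  obtain ⟨y, hlim, hxy⟩ : ∃ y : V → ℝ, Tendsto x atTop (𝓝 y) ∧ ∀ t ∈ Ici (0 : ℝ), x t ≤ y := by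
    have hmono' : ∀ i, Monotone fun t => x (max t 0) i := fun i s t hst =>
      hmono (mem_Ici.2 (le_max_right s 0)) (mem_Ici.2 (le_max_right t 0)) (max_le_max_right 0 hst) i
    have hbdd : ∀ i, BddAbove (range fun t => x (max t 0) i) := fun i =>
      ⟨hi i, by rintro _ ⟨t, rfl⟩; exact (hx _ (mem_Ici.2 (le_max_right t 0))).2.2 i⟩
    refine ⟨fun i => ⨆ t, x (max t 0) i, tendsto_pi_nhds.2 fun i => ?_, fun t ht i => ?_⟩
    · refine (tendsto_atTop_ciSup (hmono' i) (hbdd i)).congr' ?_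
      filter_upwards [eventually_ge_atTop 0] with t ht
      rw [max_eq_left ht]
    · have := le_ciSup (hbdd i) t
      rwa [max_eq_left ht] at this
  have hx₀y : x₀ ≤ y := hx0 ▸ hxy 0 self_mem_Ici
  have hyS : y ∈ Icc lo hi := ⟨hx₀S.1.trans hx₀y, le_of_tendsto hlim
    ((eventually_ge_atTop 0).mono fun t ht => (hxS t ht).2)⟩
  have hFy : F y = 0 :=
    eq_zero_of_tendsto_of_hasDerivWithinAt hK.continuousOn (fun t ht => (hx t ht).1) hxS hyS hlim
  refine ⟨y, hFy, hx₀y, x, hx0, fun t ht => ⟨(hx t ht).1, (hx t ht).2.1, hxy t ht⟩, ?_⟩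
  obtain ⟨d, hd, c, hc, δ, hδ, hlin⟩ := hstab y (hSpos hyS) hFy
  -- Shrink `δ` so that `y - s • d` stays in the box for `s ≤ δ`.
  obtain ⟨ε, ⟨hε, hεδ⟩, hεd⟩ : ∃ ε : ℝ, (0 < ε ∧ ε ≤ δ) ∧ ∀ i, ε * d i < x₀ i / 2 := by
    have h1 : ∀ᶠ s in 𝓝[>] (0 : ℝ), ∀ i, s * d i < x₀ i / 2 := by
      refine eventually_all.2 fun i => nhdsWithin_le_nhds ?_
      have h2 : Tendsto (fun s : ℝ => s * d i) (𝓝 0) (𝓝 (0 * d i)) :=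
        tendsto_id.mul_const (d i)
      exact h2.eventually_lt_const (by simpa using hx₀ i)
    have h3 : ∀ᶠ s in 𝓝[>] (0 : ℝ), 0 < s ∧ s ≤ δ := Ioc_mem_nhdsGT hδ
    exact (h3.and h1).exists
  set D : ℝ := 1 + ∑ i, d i with hD
  have hdD : ∀ i, d i ≤ D := fun i => by
    have := Finset.single_le_sum (f := d) (fun j _ => (hd j).le) (Finset.mem_univ i)
    linarith
  have hD0 : 0 < D := add_pos_of_pos_of_nonneg one_pos (Finset.sum_nonneg fun j _ => (hd j).le)
  set k : ℝ := c / D with hk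
  have hk0 : 0 < k := div_pos hc hD0
  obtain ⟨T, hT0, hT⟩ : ∃ T : ℝ, 0 ≤ T ∧ y - ε • d ≤ x T := by
    have h1 : ∀ᶠ t in atTop, ∀ i, y i - ε * d i < x t i := by
      refine eventually_all.2 fun i => (tendsto_pi_nhds.1 hlim i).eventually_const_lt ?_
      have := mul_pos hε (hd i)
      linarith
    obtain ⟨T, hT, h⟩ := ((eventually_ge_atTop (0 : ℝ)).and h1).exists
    exact ⟨T, hT, fun i => (h i).le⟩
  set σ : ℝ → ℝ := fun t => ε * Real.exp (-k * (t - T)) with hσ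
  have hσ0 : ∀ t, 0 < σ t := fun t => mul_pos hε (Real.exp_pos _)
  have hσε : ∀ t, T ≤ t → σ t ≤ ε := fun t ht => by
    refine mul_le_of_le_one_right hε.le (Real.exp_le_one_iff.2 ?_)
    nlinarith
  have hlate : ∀ t, T ≤ t → y - σ t • d ≤ x t := by
    intro t ht
    have hσd : ∀ s, HasDerivAt σ (-k * σ s) s := by
      intro s
      have h1 : HasDerivAt (fun s => -k * (s - T)) (-k) s := by
        simpa using ((hasDerivAt_id s).sub_const T).const_mul (-k)
      refine (h1.exp.const_mul ε).congr_deriv ?_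
      simp only [hσ]; ring
    have hv : ∀ s, HasDerivAt (fun s => y - σ s • d) (-((-k * σ s) • d)) s := fun s =>
      ((hσd s).smul_const d).const_sub y
    refine hqS.le_of_subsolution_of_supersolution hK
      (fun u hu v hv => ⟨hu.1.trans le_sup_left, sup_le hu.2 hv.2⟩)
      (v := fun s => y - σ s • d) (v' := fun s => -((-k * σ s) • d)) (w' := fun s => F (x s))
      (a := T) (b := t)
      (fun s _ => (hv s).hasDerivWithinAt)
      (fun s hs => (hx s (hT0.trans hs.1)).1.mono
        (Icc_subset_Ici_self.trans (Ici_subset_Ici.2 hT0)))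
      (fun s hs => ⟨fun i => ?_, fun i => ?_⟩) (fun s hs => hxS s (hT0.trans hs.1))
      (fun s hs i => ?_) (fun s _ => le_rfl) ?_ t (right_mem_Icc.2 ht)
    · have h1 := mul_le_mul_of_nonneg_right (hσε s hs.1) (hd i).le
      have h2 := hεd i
      have h3 := hx₀y i
      simp only [hlo, Pi.sub_apply, Pi.smul_apply, smul_eq_mul]
      linarith
    · have h1 := mul_pos (hσ0 s) (hd i)
      have h2 := hyS.2 i
      simp only [Pi.sub_apply, Pi.smul_apply, smul_eq_mul]
      linarith
    · refine le_trans ?_ (hlin (σ s) ⟨(hσ0 s).le, (hσε s hs.1).trans hεδ⟩ i)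
      have h1 : k * d i ≤ c := by
        rw [hk, div_mul_eq_mul_div, div_le_iff₀ hD0]
        exact mul_le_mul_of_nonneg_left (hdD i) hc.le
      have h2 := mul_le_mul_of_nonneg_right h1 (hσ0 s).le
      simp only [Pi.neg_apply, Pi.smul_apply, smul_eq_mul]
      linarith
    · simpa [hσ] using hT
  refine ⟨(‖y - x₀‖ + ε * D) * Real.exp (k * T), k, hk0, fun t ht => ?_⟩
  have hexp : Real.exp (k * T) * Real.exp (-k * t) = Real.exp (-k * (t - T)) := by
    rw [← Real.exp_add]; ring_nf
  rw [mul_assoc, hexp, norm_sub_rev]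
  refine (pi_norm_le_iff_of_nonneg (by positivity)).2 fun i => ?_
  have h0 : 0 ≤ y i - x t i := sub_nonneg.2 (hxy t ht i)
  rw [Pi.sub_apply, Real.norm_of_nonneg h0, add_mul]
  rcases le_total T t with hTt | hTt
  · have h1 := hlate t hTt i
    have h2 := mul_le_mul_of_nonneg_left (hdD i) (hσ0 t).le
    have h3 : 0 ≤ ‖y - x₀‖ * Real.exp (-k * (t - T)) := by positivity
    simp only [Pi.sub_apply, Pi.smul_apply, smul_eq_mul] at h1
    have h4 : σ t * D = ε * D * Real.exp (-k * (t - T)) := by simp only [hσ]; ring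
    linarith
  · have h1 : y i - x t i ≤ ‖y - x₀‖ := by
      have h2 := (le_abs_self _).trans (norm_le_pi_norm (y - x₀) i)
      have h3 := (hx t ht).2.1 i
      simp only [Pi.sub_apply] at h2
      linarith
    have h2 : 1 ≤ Real.exp (-k * (t - T)) := Real.one_le_exp (by nlinarith)
    have h3 : 0 ≤ ε * D * Real.exp (-k * (t - T)) := by positivity
    have h4 := mul_le_mul_of_nonneg_left h2 (norm_nonneg (y - x₀))
    linarith

/-- Solutions of an autonomous differential equation on the positive orthant are unique if the
vector field is Lipschitz on boxes. -/
theorem eqOn_of_hasDerivWithinAt_of_pos {V : Type*} [Fintype V] {F : (V → ℝ) → V → ℝ}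
    (hF : ∀ lo hi : V → ℝ, (∀ i, 0 < lo i) → ∃ K, LipschitzOnWith K F (Icc lo hi))
    {x y : ℝ → V → ℝ} {T : ℝ}
    (hx : ∀ t ∈ Icc 0 T, HasDerivWithinAt x (F (x t)) (Icc 0 T) t)
    (hy : ∀ t ∈ Icc 0 T, HasDerivWithinAt y (F (y t)) (Icc 0 T) t)
    (hxpos : ∀ t ∈ Icc 0 T, ∀ i, 0 < x t i) (hypos : ∀ t ∈ Icc 0 T, ∀ i, 0 < y t i)
    (h0 : x 0 = y 0) : EqOn x y (Icc 0 T) := by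
  rcases lt_or_ge T 0 with hT | hT
  · simp [Icc_eq_empty_of_lt hT]
  have hxc : ContinuousOn x (Icc 0 T) := fun t ht => (hx t ht).continuousWithinAt
  have hyc : ContinuousOn y (Icc 0 T) := fun t ht => (hy t ht).continuousWithinAt
  have hmin : ∀ {z : ℝ → V → ℝ}, ContinuousOn z (Icc 0 T) → (∀ t ∈ Icc 0 T, ∀ i, 0 < z t i) →
      ∃ lo hi : V → ℝ, (∀ i, 0 < lo i) ∧ ∀ t ∈ Icc 0 T, z t ∈ Icc lo hi := by
    intro z hz hpos
    have h1 : ∀ i, ∃ l u : ℝ, 0 < l ∧ ∀ t ∈ Icc 0 T, l ≤ z t i ∧ z t i ≤ u := by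
      intro i
      have hzi : ContinuousOn (fun t => z t i) (Icc 0 T) := continuousOn_pi.1 hz i
      obtain ⟨s, hs, hs'⟩ := isCompact_Icc.exists_isMinOn (nonempty_Icc.2 hT) hzi
      obtain ⟨u, hu, hu'⟩ := isCompact_Icc.exists_isMaxOn (nonempty_Icc.2 hT) hzi
      exact ⟨z s i, z u i, hpos s hs i, fun t ht => ⟨hs' ht, hu' ht⟩⟩
    choose l u hl hlu using h1
    exact ⟨l, u, hl, fun t ht => ⟨fun i => (hlu i t ht).1, fun i => (hlu i t ht).2⟩⟩
  obtain ⟨l₁, u₁, hl₁, hz₁⟩ := hmin hxc hxpos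
  obtain ⟨l₂, u₂, hl₂, hz₂⟩ := hmin hyc hypos
  obtain ⟨K, hK⟩ := hF (l₁ ⊓ l₂) (u₁ ⊔ u₂) fun i => lt_min (hl₁ i) (hl₂ i)
  have hright : ∀ {z : ℝ → V → ℝ}, (∀ t ∈ Icc 0 T, HasDerivWithinAt z (F (z t)) (Icc 0 T) t) →
      ∀ t ∈ Ico 0 T, HasDerivWithinAt z (F (z t)) (Ici t) t := fun hz t ht =>
    ((hz t (Ico_subset_Icc_self ht)).mono (Icc_subset_Icc_left ht.1)).mono_of_mem_nhdsWithin
      (Icc_mem_nhdsGE ht.2)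
  exact ODE_solution_unique_of_mem_Icc_right (v := fun _ => F)
    (s := fun _ => Icc (l₁ ⊓ l₂) (u₁ ⊔ u₂)) (fun _ _ => hK) hxc (hright hx)
    (fun t ht => have h := hz₁ t (Ico_subset_Icc_self ht)
      ⟨inf_le_left.trans h.1, h.2.trans le_sup_left⟩) hyc (hright hy)
    (fun t ht => have h := hz₂ t (Ico_subset_Icc_self ht)
      ⟨inf_le_right.trans h.1, h.2.trans le_sup_right⟩) h0

/-! ### Polynomial identities for hyperbolic triangles of circle packings

In this part `c` and `s` stand for the hyperbolic cosine and sine of the radii at the vertices `i`,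
`j`, `k` of a triangle, and `p`, `q`, `w` for the cosines of the weights of the edges `ij`, `ik`,
`jk`. Then `A`, `B`, `C` are the hyperbolic cosines of the lengths of these edges. -/

/-- The Gram determinant of a triangle is positive: after elimination of the squares `c²` it is a
polynomial all of whose coefficients are nonnegative for `p, q, w ∈ [0, 1]`. -/
theorem gram_pos {ci si cj sj ck sk p q w A B C : ℝ}
    (hi : ci ^ 2 = 1 + si ^ 2) (hj : cj ^ 2 = 1 + sj ^ 2) (hk : ck ^ 2 = 1 + sk ^ 2)
    (hci : 0 < ci) (hsi : 0 < si) (hcj : 0 < cj) (hsj : 0 < sj) (hck : 0 < ck) (hsk : 0 < sk)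
    (hp : p ∈ Icc (0 : ℝ) 1) (hq : q ∈ Icc (0 : ℝ) 1) (hw : w ∈ Icc (0 : ℝ) 1)
    (hA : A = ci * cj + si * sj * p) (hB : B = ci * ck + si * sk * q)
    (hC : C = cj * ck + sj * sk * w) :
    0 < 1 + 2 * A * B * C - A ^ 2 - B ^ 2 - C ^ 2 := by
  obtain ⟨hp0, hp1⟩ := hp
  obtain ⟨hq0, hq1⟩ := hq
  obtain ⟨hw0, hw1⟩ := hw
  have hp2 : 0 ≤ 1 - p ^ 2 := by nlinarith
  have hq2 : 0 ≤ 1 - q ^ 2 := by nlinarith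
  have hw2 : 0 ≤ 1 - w ^ 2 := by nlinarith
  have key : 1 + 2 * A * B * C - A ^ 2 - B ^ 2 - C ^ 2 =
      2 * (si * sj * sk) ^ 2 * (1 + p * q * w)
      + 2 * ci * cj * si * sj * sk ^ 2 * (p + q * w) + 2 * ci * ck * si * sj ^ 2 * sk * (p * w + q)
      + 2 * cj * ck * si ^ 2 * sj * sk * (p * q + w) + (si * sj) ^ 2 * (1 - p ^ 2)
      + (si * sk) ^ 2 * (1 - q ^ 2) + (sj * sk) ^ 2 * (1 - w ^ 2) := by
    subst hA hB hC
    linear_combination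
      (2 * cj ^ 2 * ck ^ 2 - cj ^ 2 + 2 * cj * ck * sj * sk * w - ck ^ 2) * hi
      + (2 * ci * ck * si * sk * q + 2 * ck ^ 2 * si ^ 2 + ck ^ 2 - si ^ 2 - 1) * hj
      + (2 * ci * cj * si * sj * p + 2 * si ^ 2 * sj ^ 2 + si ^ 2 + sj ^ 2) * hk
  rw [key]
  positivity

/-- The numerator of the derivative of the angle at `i` with respect to the radius at `j` (minus the
numerator in `hasDerivAt_cosLaw`, without the factor `B ^ 2 - 1`). -/
theorem angle_deriv_numerator_eq {ci si cj sj ck sk p q w A B C : ℝ}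
    (hi : ci ^ 2 = 1 + si ^ 2) (hj : cj ^ 2 = 1 + sj ^ 2)
    (hA : A = ci * cj + si * sj * p) (hB : B = ci * ck + si * sk * q)
    (hC : C = cj * ck + sj * sk * w) :
    (ck * sj + sk * cj * w) * (A ^ 2 - 1) - (ci * sj + si * cj * p) * (A * C - B) =
      si * (ci * sj * sk * (p * w + q) + cj * si * sk * (p * q + w)
        + ck * si * sj * (1 - p ^ 2)) := by
  subst hA hB hC
  linear_combination
    (cj ^ 3 * sk * w - cj * sj ^ 2 * sk * w + ck * sj) * hi
    + (-ci * cj * ck * si * p + ci * si * sj * sk * p * w + cj * si ^ 2 * sk * w + cj * sk * w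
      - ck * si ^ 2 * sj * p ^ 2) * hj

/-- In the coordinates `u = log tanh (r / 2)`, for which `∂/∂u = sinh r ∂/∂r`, the Jacobian matrix
of the angles is symmetric. -/
theorem angle_deriv_symm {ci si cj sj ck sk p q w A B C : ℝ}
    (hi : ci ^ 2 = 1 + si ^ 2) (hj : cj ^ 2 = 1 + sj ^ 2)
    (hA : A = ci * cj + si * sj * p) (hB : B = ci * ck + si * sk * q)
    (hC : C = cj * ck + sj * sk * w) :
    sj * ((ck * sj + sk * cj * w) * (A ^ 2 - 1) - (ci * sj + si * cj * p) * (A * C - B)) =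
      si * ((ck * si + sk * ci * q) * (A ^ 2 - 1) - (cj * si + sj * ci * p) * (A * B - C)) := by
  rw [angle_deriv_numerator_eq hi hj hA hB hC,
    angle_deriv_numerator_eq (p := p) (q := w) (w := q) hj hi (by rw [hA]; ring) hC hB]
  ring

/-- This expression is, up to positive factors, the derivative of the area of the triangle, `π`
minus its angle sum, with respect to the radius at `i`. -/
theorem area_deriv_numerator_pos {ci si cj sj ck sk p q w A B C : ℝ}
    (hi : ci ^ 2 = 1 + si ^ 2) (hj : cj ^ 2 = 1 + sj ^ 2) (hk : ck ^ 2 = 1 + sk ^ 2)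
    (hci : 0 < ci) (hsi : 0 < si) (hcj : 0 < cj) (hsj : 0 < sj) (hck : 0 < ck) (hsk : 0 < sk)
    (hp : p ∈ Icc (0 : ℝ) 1) (hq : q ∈ Icc (0 : ℝ) 1) (hw : w ∈ Icc (0 : ℝ) 1)
    (hA : A = ci * cj + si * sj * p) (hB : B = ci * ck + si * sk * q)
    (hC : C = cj * ck + sj * sk * w) :
    0 < (cj * si + sj * ci * p) * (B + 1) * (B + C - A - 1)
      + (ck * si + sk * ci * q) * (A + 1) * (A + C - B - 1) := by
  obtain ⟨hp0, hp1⟩ := hp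
  obtain ⟨hq0, hq1⟩ := hq
  obtain ⟨hw0, hw1⟩ := hw
  have hp2 : 0 ≤ 1 - p ^ 2 := by nlinarith
  have hq2 : 0 ≤ 1 - q ^ 2 := by nlinarith
  have key : (cj * si + sj * ci * p) * (B + 1) * (B + C - A - 1)
      + (ck * si + sk * ci * q) * (A + 1) * (A + C - B - 1) =
      2 * ci * cj * ck * si * sj * sk * (p * q + w) + 2 * ci * si * (sj * sk) ^ 2 * (1 + p * q * w)
      + ci * si * sj ^ 2 * (1 - p ^ 2) + ci * si * sk ^ 2 * (1 - q ^ 2)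
      + ci * sj ^ 2 * sk * (p * w + q) + ci * sj * sk ^ 2 * (p + q * w)
      + 2 * cj * si ^ 2 * sj * sk ^ 2 * (p + q * w) + cj * si * sj * sk * (p * q + w)
      + cj * si * sk ^ 2 * (1 - q ^ 2) + cj * sj * sk ^ 2 * (p + q * w)
      + 2 * ck * si ^ 2 * sj ^ 2 * sk * (p * w + q) + ck * si * sj ^ 2 * (1 - p ^ 2)
      + ck * si * sj * sk * (p * q + w) + ck * sj ^ 2 * sk * (p * w + q) := by
    subst hA hB hC
    linear_combination
      (ci * cj ^ 2 * sk * q - ci * cj * ck * sj * p - ci * cj * ck * sk * q + ci * ck ^ 2 * sj * p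
        + cj ^ 2 * ck * sk * q + cj * ck ^ 2 * sj * p + cj * si * sj * sk * p * q
        - cj * si * sk ^ 2 * q ^ 2 + cj * sj * sk ^ 2 * q * w - cj * sj * p
        - ck * si * sj ^ 2 * p ^ 2 + ck * si * sj * sk * p * q + ck * sj ^ 2 * sk * p * w
        - ck * sk * q) * hi
      + (2 * ci * ck ^ 2 * si - ci * si + ci * sk * q + 2 * ck * si ^ 2 * sk * q + ck * si
        + ck * sk * q) * hj
      + (2 * ci * si * sj ^ 2 + ci * si + ci * sj * p + 2 * cj * si ^ 2 * sj * p + cj * si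
        + cj * sj * p) * hk
  rw [key]
  positivity

/-- The numerator of the derivative of `cos θ_i` when all `tanh (r / 2)` are scaled up
simultaneously. By symmetry of the Jacobian matrix it is a positive multiple of the derivative of
the area with respect to the radius at `i`. -/
theorem scaling_deriv_numerator_pos {ci si cj sj ck sk p q w A B C : ℝ}
    (hi : ci ^ 2 = 1 + si ^ 2) (hj : cj ^ 2 = 1 + sj ^ 2) (hk : ck ^ 2 = 1 + sk ^ 2)
    (hci : 0 < ci) (hsi : 0 < si) (hcj : 0 < cj) (hsj : 0 < sj) (hck : 0 < ck) (hsk : 0 < sk)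
    (hp : p ∈ Icc (0 : ℝ) 1) (hq : q ∈ Icc (0 : ℝ) 1) (hw : w ∈ Icc (0 : ℝ) 1)
    (hA : A = ci * cj + si * sj * p) (hB : B = ci * ck + si * sk * q)
    (hC : C = cj * ck + sj * sk * w) (hA1 : 1 < A) (hB1 : 1 < B) :
    0 < (si * (cj * si + sj * ci * p) + sj * (ci * sj + si * cj * p)) * (B ^ 2 - 1) * (A * C - B)
      + (si * (ck * si + sk * ci * q) + sk * (ci * sk + si * ck * q)) * (A ^ 2 - 1) * (B * C - A)
      - (sj * (ck * sj + sk * cj * w) + sk * (cj * sk + sj * ck * w))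
        * (A ^ 2 - 1) * (B ^ 2 - 1) := by
  have h1 := angle_deriv_symm hi hj hA hB hC
  have h2 := angle_deriv_symm (p := q) (q := p) (w := w) hi hk hB hA (hC.trans (by ring))
  have h3 := area_deriv_numerator_pos hi hj hk hci hsi hcj hsj hck hsk hp hq hw hA hB hC
  have key : (si * (cj * si + sj * ci * p) + sj * (ci * sj + si * cj * p))
        * (B ^ 2 - 1) * (A * C - B)
      + (si * (ck * si + sk * ci * q) + sk * (ci * sk + si * ck * q)) * (A ^ 2 - 1) * (B * C - A)
      - (sj * (ck * sj + sk * cj * w) + sk * (cj * sk + sj * ck * w))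
        * (A ^ 2 - 1) * (B ^ 2 - 1) =
      si * (A - 1) * (B - 1) * ((cj * si + sj * ci * p) * (B + 1) * (B + C - A - 1)
        + (ck * si + sk * ci * q) * (A + 1) * (A + C - B - 1)) := by
    linear_combination (-(B ^ 2 - 1)) * h1 - (A ^ 2 - 1) * h2
  rw [key]
  have := sub_pos.2 hA1
  have := sub_pos.2 hB1
  positivity

/-! ### The angles of a triangle as functions of the radii -/

/-- The hyperbolic cosine of the length of an edge with radii `x`, `y` at its end points, where `p`
is the cosine of the weight of the edge. -/
noncomputable def coshEdge (p x y : ℝ) : ℝ :=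
  Real.cosh x * Real.cosh y + Real.sinh x * Real.sinh y * p

/-- The cosine of the angle opposite to the third side of a hyperbolic triangle, in terms of the
hyperbolic cosines `A`, `B`, `C` of the sides; for `1 ≤ A` the square root `√(A ^ 2 - 1)` is the
hyperbolic sine of the first side. -/
noncomputable def cosLaw (A B C : ℝ) : ℝ :=
  (A * B - C) / (√(A ^ 2 - 1) * √(B ^ 2 - 1))

/-- The angle at the first vertex of a triangle with radii `x`, `y`, `z`, where `p`, `q`, `w` are
the cosines of the weights of the edges `xy`, `xz`, `yz`. -/
noncomputable def angle (p q w x y z : ℝ) : ℝ :=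
  Real.arccos (cosLaw (coshEdge p x y) (coshEdge q x z) (coshEdge w y z))

theorem coshEdge_comm (p x y : ℝ) : coshEdge p x y = coshEdge p y x := by
  unfold coshEdge; ring

theorem cosLaw_comm (A B C : ℝ) : cosLaw A B C = cosLaw B A C := by
  unfold cosLaw; rw [mul_comm A, mul_comm √(A ^ 2 - 1)]

theorem angle_comm (p q w x y z : ℝ) : angle p q w x y z = angle q p w x z y := by
  unfold angle; rw [cosLaw_comm, coshEdge_comm w]

theorem cosh_mul_cosh_le_coshEdge {p x y : ℝ} (hp : 0 ≤ p) (hx : 0 < x) (hy : 0 < y) :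
    Real.cosh x * Real.cosh y ≤ coshEdge p x y := by
  have h1 := Real.sinh_pos_iff.2 hx
  have h2 := Real.sinh_pos_iff.2 hy
  have : 0 ≤ Real.sinh x * Real.sinh y * p := by positivity
  unfold coshEdge; linarith

theorem one_lt_coshEdge {p x y : ℝ} (hp : 0 ≤ p) (hx : 0 < x) (hy : 0 < y) :
    1 < coshEdge p x y := by
  refine lt_of_lt_of_le ?_ (cosh_mul_cosh_le_coshEdge hp hx hy)
  have h1 := Real.one_lt_cosh.2 hx.ne'
  have h2 := Real.one_lt_cosh.2 hy.ne'
  nlinarith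

theorem abs_cosLaw_lt_one {A B C : ℝ} (hA : 1 < A) (hB : 1 < B)
    (h : 0 < 1 + 2 * A * B * C - A ^ 2 - B ^ 2 - C ^ 2) : |cosLaw A B C| < 1 := by
  have hP : 0 < A ^ 2 - 1 := by nlinarith
  have hQ : 0 < B ^ 2 - 1 := by nlinarith
  have hPQ : 0 < √(A ^ 2 - 1) * √(B ^ 2 - 1) := by positivity
  rw [cosLaw, abs_div, abs_of_pos hPQ, div_lt_one hPQ]
  refine abs_lt_of_sq_lt_sq ?_ hPQ.le
  rw [mul_pow, Real.sq_sqrt hP.le, Real.sq_sqrt hQ.le]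
  linarith

theorem abs_cosLaw_coshEdge_lt_one {p q w x y z : ℝ} (hp : p ∈ Icc (0 : ℝ) 1)
    (hq : q ∈ Icc (0 : ℝ) 1) (hw : w ∈ Icc (0 : ℝ) 1) (hx : 0 < x) (hy : 0 < y) (hz : 0 < z) :
    |cosLaw (coshEdge p x y) (coshEdge q x z) (coshEdge w y z)| < 1 :=
  abs_cosLaw_lt_one (one_lt_coshEdge hp.1 hx hy) (one_lt_coshEdge hq.1 hx hz)
    (gram_pos (by linarith [Real.cosh_sq x]) (by linarith [Real.cosh_sq y])
      (by linarith [Real.cosh_sq z]) (Real.cosh_pos x) (Real.sinh_pos_iff.2 hx) (Real.cosh_pos y)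
      (Real.sinh_pos_iff.2 hy) (Real.cosh_pos z) (Real.sinh_pos_iff.2 hz) hp hq hw rfl rfl rfl)

theorem hasDerivAt_cosLaw {A B C : ℝ → ℝ} {A' B' C' t : ℝ} (hA : HasDerivAt A A' t)
    (hB : HasDerivAt B B' t) (hC : HasDerivAt C C' t) (hA1 : 1 < A t) (hB1 : 1 < B t) :
    HasDerivAt (fun s => cosLaw (A s) (B s) (C s))
      ((A' * (B t ^ 2 - 1) * (A t * C t - B t) + B' * (A t ^ 2 - 1) * (B t * C t - A t)
        - C' * (A t ^ 2 - 1) * (B t ^ 2 - 1)) / (√(A t ^ 2 - 1) * √(B t ^ 2 - 1)) ^ 3) t := by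
  have hP : 0 < A t ^ 2 - 1 := by nlinarith
  have hQ : 0 < B t ^ 2 - 1 := by nlinarith
  have hp := ((hA.fun_pow 2).sub_const 1).sqrt hP.ne'
  have hq := ((hB.fun_pow 2).sub_const 1).sqrt hQ.ne'
  have ha := Real.sqrt_pos.2 hP
  have hb := Real.sqrt_pos.2 hQ
  have ha2 := Real.sq_sqrt hP.le
  have hb2 := Real.sq_sqrt hQ.le
  refine (((hA.fun_mul hB).fun_sub hC).fun_div (hp.fun_mul hq) (mul_pos ha hb).ne').congr_deriv ?_
  set a := √(A t ^ 2 - 1)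
  set b := √(B t ^ 2 - 1)
  field_simp
  rw [ha2, hb2]
  push_cast
  ring

theorem hasDerivAt_coshEdge {X Y : ℝ → ℝ} {X' Y' t : ℝ} (p : ℝ) (hX : HasDerivAt X X' t)
    (hY : HasDerivAt Y Y' t) : HasDerivAt (fun s => coshEdge p (X s) (Y s))
      (X' * (Real.cosh (Y t) * Real.sinh (X t) + Real.sinh (Y t) * Real.cosh (X t) * p)
        + Y' * (Real.cosh (X t) * Real.sinh (Y t) + Real.sinh (X t) * Real.cosh (Y t) * p)) t := by
  refine ((hX.cosh.fun_mul hY.cosh).fun_add ((hX.sinh.fun_mul hY.sinh).mul_const p)).congr_deriv ?_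
  ring

/-- Thurston's monotonicity: the angle at a vertex does not decrease when the radius at another
vertex increases. -/
theorem angle_mono {p q w x y y' z : ℝ} (hp : p ∈ Icc (0 : ℝ) 1) (hq : q ∈ Icc (0 : ℝ) 1)
    (hw : w ∈ Icc (0 : ℝ) 1) (hx : 0 < x) (hz : 0 < z) (hy : 0 < y) (hyy' : y ≤ y') :
    angle p q w x y z ≤ angle p q w x y' z := by
  have hd : ∀ u ∈ Ioi (0 : ℝ), HasDerivAt
      (fun u => cosLaw (coshEdge p x u) (coshEdge q x z) (coshEdge w u z)) _ u := fun u hu =>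
    hasDerivAt_cosLaw (hasDerivAt_coshEdge p (hasDerivAt_const u x) (hasDerivAt_id u))
      (hasDerivAt_const u _) (hasDerivAt_coshEdge w (hasDerivAt_id u) (hasDerivAt_const u z))
      (one_lt_coshEdge hp.1 hx hu) (one_lt_coshEdge hq.1 hx hz)
  have hanti : AntitoneOn (fun u => cosLaw (coshEdge p x u) (coshEdge q x z) (coshEdge w u z))
      (Ioi 0) := by
    refine antitoneOn_of_hasDerivWithinAt_nonpos (convex_Ioi 0)
      (fun u hu => (hd u hu).continuousAt.continuousWithinAt)
      (fun u hu => (hd u (interior_subset hu)).hasDerivWithinAt) fun u hu => ?_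
    have hu : 0 < u := interior_subset hu
    have h1 := one_lt_coshEdge hq.1 hx hz
    have hQ : 0 < coshEdge q x z ^ 2 - 1 := by nlinarith
    refine div_nonpos_of_nonpos_of_nonneg ?_ (by positivity)
    have h2 := angle_deriv_numerator_eq (p := p) (q := q) (w := w) (ci := Real.cosh x)
      (si := Real.sinh x) (cj := Real.cosh u) (sj := Real.sinh u) (ck := Real.cosh z)
      (sk := Real.sinh z) (by linarith [Real.cosh_sq x]) (by linarith [Real.cosh_sq u]) rfl rfl rfl
    have h3 : 0 ≤ Real.sinh x * (Real.cosh x * Real.sinh u * Real.sinh z * (p * w + q)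
        + Real.cosh u * Real.sinh x * Real.sinh z * (p * q + w)
        + Real.cosh z * Real.sinh x * Real.sinh u * (1 - p ^ 2)) := by
      have := Real.sinh_pos_iff.2 hx
      have := Real.sinh_pos_iff.2 hu
      have := Real.sinh_pos_iff.2 hz
      have := Real.cosh_pos x
      have := Real.cosh_pos u
      have := Real.cosh_pos z
      have := hp.1
      have := hq.1
      have := hw.1
      have : 0 ≤ 1 - p ^ 2 := by nlinarith [hp.1, hp.2]
      positivity
    rw [← h2] at h3
    have h4 := mul_nonneg h3 hQ.le
    simp only [coshEdge] at h4 ⊢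
    linarith
  exact Real.arccos_le_arccos (hanti hy (hy.trans_le hyy') hyy')

/-- The angles of a triangle increase strictly, to first order, when all `tanh (r / 2)` are scaled
down simultaneously. -/
theorem exists_hasDerivAt_angle_pos {p q w : ℝ} {X Y Z : ℝ → ℝ} {t : ℝ} (hp : p ∈ Icc (0 : ℝ) 1)
    (hq : q ∈ Icc (0 : ℝ) 1) (hw : w ∈ Icc (0 : ℝ) 1) (hx : 0 < X t) (hy : 0 < Y t) (hz : 0 < Z t)
    (hX : HasDerivAt X (-Real.sinh (X t)) t) (hY : HasDerivAt Y (-Real.sinh (Y t)) t)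
    (hZ : HasDerivAt Z (-Real.sinh (Z t)) t) :
    ∃ m > 0, HasDerivAt (fun s => angle p q w (X s) (Y s) (Z s)) m t := by
  have hA := one_lt_coshEdge hp.1 hx hy
  have hB := one_lt_coshEdge hq.1 hx hz
  have hPQ : 0 < √(coshEdge p (X t) (Y t) ^ 2 - 1) * √(coshEdge q (X t) (Z t) ^ 2 - 1) :=
    mul_pos (Real.sqrt_pos.2 (by nlinarith)) (Real.sqrt_pos.2 (by nlinarith))
  have hd := hasDerivAt_cosLaw (hasDerivAt_coshEdge p hX hY) (hasDerivAt_coshEdge q hX hZ)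
    (hasDerivAt_coshEdge w hY hZ) hA hB
  have hlt := abs_lt.1 (abs_cosLaw_coshEdge_lt_one hp hq hw hx hy hz)
  refine ⟨_, ?_, (Real.hasDerivAt_arccos hlt.1.ne' hlt.2.ne).comp t hd⟩
  have h1 := scaling_deriv_numerator_pos (p := p) (q := q) (w := w) (ci := Real.cosh (X t))
    (si := Real.sinh (X t)) (cj := Real.cosh (Y t)) (sj := Real.sinh (Y t)) (ck := Real.cosh (Z t))
    (sk := Real.sinh (Z t)) (by linarith [Real.cosh_sq (X t)]) (by linarith [Real.cosh_sq (Y t)])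
    (by linarith [Real.cosh_sq (Z t)]) (Real.cosh_pos _) (Real.sinh_pos_iff.2 hx) (Real.cosh_pos _)
    (Real.sinh_pos_iff.2 hy) (Real.cosh_pos _) (Real.sinh_pos_iff.2 hz) hp hq hw rfl rfl rfl hA hB
  refine mul_pos_of_neg_of_neg ?_ (div_neg_of_neg_of_pos ?_ (pow_pos hPQ 3))
  · refine neg_neg_of_pos (one_div_pos.2 (Real.sqrt_pos.2 ?_))
    nlinarith
  · simp only [coshEdge] at h1 ⊢
    linarith

theorem one_sub_cosLaw_coshEdge_le {p q w x y z : ℝ} (hp : 0 ≤ p) (hq : 0 ≤ q)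
    (hw : w ≤ 1) (hx : 0 < x) (hy : 0 < y) (hz : 0 < z) :
    1 - cosLaw (coshEdge p x y) (coshEdge q x z) (coshEdge w y z) ≤ 2 / Real.sinh x ^ 2 := by
  have hsx := Real.sinh_pos_iff.2 hx
  have hsy := Real.sinh_pos_iff.2 hy
  have hsz := Real.sinh_pos_iff.2 hz
  have hcx := Real.cosh_pos x
  have hcy := Real.cosh_pos y
  have hcz := Real.cosh_pos z
  have hside : ∀ {r u : ℝ}, 0 ≤ r → 0 < u →
      Real.sinh x * Real.cosh u ≤ √(coshEdge r x u ^ 2 - 1) := by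
    intro r u hr hu
    refine Real.le_sqrt_of_sq_le ?_
    have h1 := pow_le_pow_left₀ (mul_pos hcx (Real.cosh_pos u)).le
      (cosh_mul_cosh_le_coshEdge hr hx hu) 2
    have h2 := Real.cosh_sq x
    have h3 := Real.cosh_sq u
    nlinarith [sq_nonneg (Real.sinh u)]
  have hupper : ∀ {r u : ℝ}, 0 ≤ r → 0 < u → √(coshEdge r x u ^ 2 - 1) ≤ coshEdge r x u := by
    intro r u hr hu
    refine Real.sqrt_le_iff.2 ⟨(one_pos.trans (one_lt_coshEdge hr hx hu)).le, by linarith⟩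
  have ha := hside hp hy
  have hb := hside hq hz
  have ha' := hupper hp hy
  have hb' := hupper hq hz
  have hC : coshEdge w y z ≤ 2 * (Real.cosh y * Real.cosh z) := by
    have h1 := mul_le_mul (Real.sinh_lt_cosh y).le (Real.sinh_lt_cosh z).le hsz.le hcy.le
    have h2 := mul_le_mul_of_nonneg_left hw (mul_pos hsy hsz).le
    unfold coshEdge
    linarith
  set a := √(coshEdge p x y ^ 2 - 1)
  set b := √(coshEdge q x z ^ 2 - 1)
  have ha0 : 0 < a := (mul_pos hsx hcy).trans_le ha
  have hb0 : 0 < b := (mul_pos hsx hcz).trans_le hb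
  have hab : a * b ≤ coshEdge p x y * coshEdge q x z :=
    mul_le_mul ha' hb' hb0.le (ha0.le.trans ha')
  have hab' : Real.sinh x * Real.cosh y * (Real.sinh x * Real.cosh z) ≤ a * b :=
    mul_le_mul ha hb (by positivity) ha0.le
  have h1 : 1 - cosLaw (coshEdge p x y) (coshEdge q x z) (coshEdge w y z) =
      (a * b - coshEdge p x y * coshEdge q x z + coshEdge w y z) / (a * b) := by
    change 1 - _ / (a * b) = _
    rw [one_sub_div (mul_pos ha0 hb0).ne', sub_add]
  rw [h1, div_le_div_iff₀ (mul_pos ha0 hb0) (by positivity)]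
  calc (a * b - coshEdge p x y * coshEdge q x z + coshEdge w y z) * Real.sinh x ^ 2
      ≤ 2 * (Real.cosh y * Real.cosh z) * Real.sinh x ^ 2 := by gcongr; linarith
    _ = 2 * (Real.sinh x * Real.cosh y * (Real.sinh x * Real.cosh z)) := by ring
    _ ≤ 2 * (a * b) := by linarith

/-- The angle at a vertex tends to zero when the radius there tends to infinity, uniformly in the
other radii. -/
theorem exists_forall_angle_le {ε : ℝ} (hε : 0 < ε) : ∃ M : ℝ, ∀ p q w x y z : ℝ, 0 ≤ p → 0 ≤ q →
    w ≤ 1 → 0 < x → 0 < y → 0 < z → M ≤ Real.sinh (x / 2) ^ 2 → angle p q w x y z ≤ ε := by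
  set ε' := min ε Real.pi with hε'
  have h0 : 0 < ε' := lt_min hε Real.pi_pos
  have hη : 0 < 1 - Real.cos ε' := by
    have := Real.cos_lt_cos_of_nonneg_of_le_pi le_rfl (min_le_right ε Real.pi) h0
    rw [Real.cos_zero] at this
    linarith
  refine ⟨2 / (1 - Real.cos ε'), fun p q w x y z hp hq hw hx hy hz hM => ?_⟩
  have h1 := one_sub_cosLaw_coshEdge_le hp hq hw hx hy hz
  have hs := Real.sinh_pos_iff.2 hx
  have h2 : Real.sinh (x / 2) ^ 2 ≤ Real.sinh x ^ 2 :=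
    pow_le_pow_left₀ (Real.sinh_pos_iff.2 (by linarith)).le (Real.sinh_le_sinh.2 (by linarith)) 2
  have h3 : 2 / Real.sinh x ^ 2 ≤ 1 - Real.cos ε' := by
    have := hM.trans h2
    rw [div_le_iff₀ hη] at this
    rw [div_le_iff₀ (by positivity)]
    linarith
  calc angle p q w x y z ≤ Real.arccos (Real.cos ε') := Real.arccos_le_arccos (by linarith)
    _ = ε' := Real.arccos_cos h0.le (min_le_right _ _)
    _ ≤ ε := min_le_left _ _

theorem contDiffAt_coshEdge {E : Type*} [NormedAddCommGroup E] [NormedSpace ℝ E] {n : WithTop ℕ∞}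
    {X Y : E → ℝ} {v : E} (p : ℝ) (hX : ContDiffAt ℝ n X v) (hY : ContDiffAt ℝ n Y v) :
    ContDiffAt ℝ n (fun u => coshEdge p (X u) (Y u)) v :=
  (hX.cosh.mul hY.cosh).add ((hX.sinh.mul hY.sinh).mul contDiffAt_const)

theorem contDiffAt_angle {E : Type*} [NormedAddCommGroup E] [NormedSpace ℝ E] {n : WithTop ℕ∞}
    {p q w : ℝ} {X Y Z : E → ℝ} {v : E} (hp : p ∈ Icc (0 : ℝ) 1)
    (hq : q ∈ Icc (0 : ℝ) 1) (hw : w ∈ Icc (0 : ℝ) 1) (hX : ContDiffAt ℝ n X v)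
    (hY : ContDiffAt ℝ n Y v) (hZ : ContDiffAt ℝ n Z v) (hx : 0 < X v) (hy : 0 < Y v)
    (hz : 0 < Z v) : ContDiffAt ℝ n (fun u => angle p q w (X u) (Y u) (Z u)) v := by
  have hside : ∀ {r : ℝ} {U W : E → ℝ}, 0 ≤ r → 0 < U v → 0 < W v → ContDiffAt ℝ n U v →
      ContDiffAt ℝ n W v → ContDiffAt ℝ n (fun u => √(coshEdge r (U u) (W u) ^ 2 - 1)) v ∧
        0 < √(coshEdge r (U v) (W v) ^ 2 - 1) := by
    intro r U W hr hu hw hU hW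
    have h1 := one_lt_coshEdge hr hu hw
    have h2 : 0 < coshEdge r (U v) (W v) ^ 2 - 1 := by nlinarith
    exact ⟨(((contDiffAt_coshEdge r hU hW).pow 2).sub contDiffAt_const).sqrt h2.ne',
      Real.sqrt_pos.2 h2⟩
  obtain ⟨h1, h1'⟩ := hside hp.1 hx hy hX hY
  obtain ⟨h2, h2'⟩ := hside hq.1 hx hz hX hZ
  have hlt := abs_lt.1 (abs_cosLaw_coshEdge_lt_one hp hq hw hx hy hz)
  refine (Real.contDiffAt_arccos hlt.1.ne' hlt.2.ne).comp v ?_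
  exact (((contDiffAt_coshEdge p hX hY).mul (contDiffAt_coshEdge q hX hZ)).sub
    (contDiffAt_coshEdge w hY hZ)).div (h1.mul h2) (mul_pos h1' h2').ne'

/-! ### Radii in terms of `g = sinh² (r / 2)` -/

/-- The radius `r` with `sinh² (r / 2) = g`. -/
noncomputable def radius (g : ℝ) : ℝ :=
  2 * Real.arsinh √g

theorem radius_pos {g : ℝ} (hg : 0 < g) : 0 < radius g :=
  mul_pos two_pos (Real.arsinh_pos_iff.2 (Real.sqrt_pos.2 hg))

theorem sinh_half_radius_sq {g : ℝ} (hg : 0 ≤ g) : Real.sinh (radius g / 2) ^ 2 = g := by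
  rw [radius, mul_div_cancel_left₀ _ two_ne_zero, Real.sinh_arsinh, Real.sq_sqrt hg]

theorem radius_sinh_half_sq {r : ℝ} (hr : 0 ≤ r) : radius (Real.sinh (r / 2) ^ 2) = r := by
  rw [radius, Real.sqrt_sq (Real.sinh_nonneg_iff.2 (by linarith)), Real.arsinh_sinh]
  ring

theorem radius_mono {g g' : ℝ} (h : g ≤ g') : radius g ≤ radius g' :=
  mul_le_mul_of_nonneg_left (Real.arsinh_le_arsinh.2 (Real.sqrt_le_sqrt h)) two_pos.le

theorem contDiffAt_radius {g : ℝ} (hg : 0 < g) {n : WithTop ℕ∞} : ContDiffAt ℝ n radius g :=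
  contDiffAt_const.mul (Real.contDiff_arsinh.contDiffAt.comp g (contDiffAt_fun_id.sqrt hg.ne'))

theorem hasDerivAt_radius {g : ℝ} (hg : 0 < g) :
    HasDerivAt radius (1 / (√g * √(1 + g))) g := by
  refine (((hasDerivAt_id g).sqrt hg.ne').arsinh.const_mul 2).congr_deriv ?_
  simp only [id, Real.sq_sqrt hg.le, smul_eq_mul]
  have := Real.sqrt_pos.2 hg
  have : 0 < √(1 + g) := Real.sqrt_pos.2 (by linarith)
  field_simp

theorem sinh_radius {g : ℝ} (hg : 0 ≤ g) : Real.sinh (radius g) = 2 * (√g * √(1 + g)) := by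
  rw [radius, Real.sinh_two_mul, Real.sinh_arsinh, Real.cosh_arsinh, Real.sq_sqrt hg]
  ring

/-- Along the direction `-2 g (1 + g)` the radius moves with velocity `-sinh r`; this is the
direction in which `tanh (r / 2)` is scaled down. -/
theorem hasDerivAt_radius_sub_mul {g : ℝ} (hg : 0 < g) :
    HasDerivAt (fun s : ℝ => radius (g - s * (2 * g * (1 + g)))) (-Real.sinh (radius g)) 0 := by
  have h1 : HasDerivAt (fun s : ℝ => g - s * (2 * g * (1 + g))) (-(2 * g * (1 + g))) 0 := by
    simpa using ((hasDerivAt_id (0 : ℝ)).mul_const (2 * g * (1 + g))).const_sub g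
  have h2 : HasDerivAt radius (1 / (√g * √(1 + g))) (g - 0 * (2 * g * (1 + g))) := by
    simpa using hasDerivAt_radius hg
  refine (h2.comp 0 h1).congr_deriv ?_
  rw [sinh_radius hg.le]
  have h3 := Real.sqrt_pos.2 hg
  have h4 : 0 < √(1 + g) := Real.sqrt_pos.2 (by linarith)
  have h5 := Real.sq_sqrt hg.le
  have h6 := Real.sq_sqrt (by linarith : 0 ≤ 1 + g)
  field_simp
  rw [h5, h6]

theorem sinh_half_sq_pos {V : Type*} {r : V → ℝ} (hr : IsMetric r) (i : V) :
    0 < Real.sinh (r i / 2) ^ 2 :=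
  pow_pos (Real.sinh_pos_iff.2 (half_pos (hr i))) 2

/-! ### The combinatorial Ricci flow as a quasimonotone system -/

variable {V : Type*} [Fintype V] {X : Type*} [TopologicalSpace X]

theorem Triangulation.pair_mem_edges (T : Triangulation V X) {f : Finset V} (hf : f ∈ T.triangles)
    {e : Finset V} (he : e ⊆ f) (hcard : e.card = 2) : e ∈ T.edges :=
  ⟨T.complex.isRelLowerSet_faces.mem_of_le hf.1 he (Finset.card_pos.1 (by omega)), hcard⟩

theorem IsWeight.cos_mem {T : Triangulation V X} {Φ : Finset V → ℝ} (hΦ : IsWeight T Φ)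
    {e : Finset V} (he : e ∈ T.edges) : Real.cos (Φ e) ∈ Icc (0 : ℝ) 1 := by
  have h := hΦ e he
  exact ⟨Real.cos_nonneg_of_mem_Icc ⟨by linarith [h.1, Real.pi_pos], h.2⟩, Real.cos_le_one _⟩

open Classical in
theorem IsWeight.cos_mem_of_triangle {T : Triangulation V X} {Φ : Finset V → ℝ} (hΦ : IsWeight T Φ)
    {i j k : V} (h : ({i, j, k} : Finset V) ∈ T.triangles) :
    Real.cos (Φ {i, j}) ∈ Icc (0 : ℝ) 1 ∧ Real.cos (Φ {i, k}) ∈ Icc (0 : ℝ) 1 ∧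
      Real.cos (Φ {j, k}) ∈ Icc (0 : ℝ) 1 := by
  obtain ⟨hij, hik, hjk⟩ : i ≠ j ∧ i ≠ k ∧ j ≠ k := by
    have key : ∀ a b : V, ¬({i, j, k} : Finset V) ⊆ {a, b} := fun a b hab => by
      have h1 := h.2
      have h2 := (Finset.card_le_card hab).trans Finset.card_le_two
      omega
    exact ⟨fun e => key i k (by simp [e]), fun e => key i j (by simp [e, Finset.insert_subset_iff]),
      fun e => key i j (by simp [e])⟩
  refine ⟨hΦ.cos_mem (T.pair_mem_edges h ?_ (Finset.card_pair hij)),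
    hΦ.cos_mem (T.pair_mem_edges h ?_ (Finset.card_pair hik)),
    hΦ.cos_mem (T.pair_mem_edges h ?_ (Finset.card_pair hjk))⟩ <;>
  · intro v hv
    simp only [Finset.mem_insert, Finset.mem_singleton] at hv ⊢
    tauto

open Classical in
/-- On a triangle the inner angle is given by the function `angle` of the radii. -/
theorem innerAngle_eq_angle {T : Triangulation V X} {Φ : Finset V → ℝ} (hΦ : IsWeight T Φ)
    {r : V → ℝ} (hr : IsMetric r) {i j k : V} (h : ({i, j, k} : Finset V) ∈ T.triangles) :
    innerAngle Φ r i j k = angle (Real.cos (Φ {i, j})) (Real.cos (Φ {i, k})) (Real.cos (Φ {j, k}))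
      (r i) (r j) (r k) := by
  obtain ⟨hp, hq, hw⟩ := hΦ.cos_mem_of_triangle h
  have hside : ∀ {a b : V}, Real.cos (Φ {a, b}) ∈ Icc (0 : ℝ) 1 →
      Real.cosh (edgeLength Φ r a b) = coshEdge (Real.cos (Φ {a, b})) (r a) (r b) ∧
      Real.sinh (edgeLength Φ r a b) = √(coshEdge (Real.cos (Φ {a, b})) (r a) (r b) ^ 2 - 1) := by
    intro a b hab
    have h1 := (one_lt_coshEdge hab.1 (hr a) (hr b)).le
    exact ⟨Real.cosh_arcosh h1, Real.sinh_arcosh h1⟩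
  rw [innerAngle, (hside hp).1, (hside hp).2, (hside hq).1, (hside hq).2, (hside hw).1]
  rfl

/-- The combinatorial Ricci flow as a vector field in the coordinates `g = sinh² (r / 2)`: the
velocity of `g i` is `-K i / (4π)`. -/
noncomputable def flowField (T : Triangulation V X) (Φ : Finset V → ℝ) (g : V → ℝ) (i : V) : ℝ :=
  -classicalCurvature T Φ (fun j => radius (g j)) i / (4 * Real.pi)

open Classical in
/-- The angle at `i` of the triangle `{i, j, k}` as a function of `g = sinh² (r / 2)`, and zero if
this is not a triangle of `T`. -/
noncomputable def cornerAngle (T : Triangulation V X) (Φ : Finset V → ℝ) (i j k : V)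
    (g : V → ℝ) : ℝ :=
  if ({i, j, k} : Finset V) ∈ T.triangles then
    angle (Real.cos (Φ {i, j})) (Real.cos (Φ {i, k})) (Real.cos (Φ {j, k}))
      (radius (g i)) (radius (g j)) (radius (g k))
  else 0

theorem flowField_eq {T : Triangulation V X} {Φ : Finset V → ℝ} (hΦ : IsWeight T Φ) {g : V → ℝ}
    (hg : ∀ i, 0 < g i) (i : V) : flowField T Φ g i =
      (1 / 2 * ∑ j, ∑ k, cornerAngle T Φ i j k g - 2 * Real.pi) / (4 * Real.pi) := by
  classical
  rw [flowField, classicalCurvature, neg_sub]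
  congr 3
  refine Finset.sum_congr rfl fun j _ => Finset.sum_congr rfl fun k _ => ?_
  rw [cornerAngle]
  split_ifs with h
  · exact innerAngle_eq_angle hΦ (fun j => radius_pos (hg j)) h
  · rfl

theorem quasimonotoneOn_flowField {T : Triangulation V X} {Φ : Finset V → ℝ} (hΦ : IsWeight T Φ) :
    QuasimonotoneOn (flowField T Φ) {g | ∀ i, 0 < g i} := by
  classical
  intro g hg g' hg' hle i hi
  rw [flowField_eq hΦ hg, flowField_eq hΦ hg']
  refine div_le_div_of_nonneg_right (sub_le_sub_right (mul_le_mul_of_nonneg_left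
    (Finset.sum_le_sum fun j _ => Finset.sum_le_sum fun k _ => ?_) (by norm_num)) _)
    (by positivity)
  unfold cornerAngle
  split_ifs with h
  · obtain ⟨hp, hq, hw⟩ := hΦ.cos_mem_of_triangle h
    have h0 : ∀ j, 0 < radius (g j) := fun j => radius_pos (hg j)
    have h0' : ∀ j, 0 < radius (g' j) := fun j => radius_pos (hg' j)
    rw [← hi]
    refine (angle_mono hp hq hw (h0 i) (h0 k) (h0 j) (radius_mono (hle j))).trans ?_
    rw [angle_comm, angle_comm (Real.cos (Φ {i, j}))]
    exact angle_mono hq hp hw (h0 i) (h0' j) (h0 k) (radius_mono (hle k))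
  · exact le_rfl

/-- The flow field is continuously differentiable on the positive orthant, because a triangle with
positive radii is nondegenerate. -/
theorem exists_lipschitzOnWith_flowField {T : Triangulation V X} {Φ : Finset V → ℝ}
    (hΦ : IsWeight T Φ) (lo hi : V → ℝ) (hlo : ∀ i, 0 < lo i) :
    ∃ K, LipschitzOnWith K (flowField T Φ) (Icc lo hi) := by
  classical
  have hpos : ∀ g ∈ Icc lo hi, ∀ i, 0 < g i := fun g hg i => (hlo i).trans_le (hg.1 i)
  refine ContDiffOn.exists_lipschitzOnWith (n := 1) ?_ one_ne_zero (convex_Icc lo hi) isCompact_Icc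
  refine ContDiffOn.congr (f := fun g i =>
    (1 / 2 * ∑ j, ∑ k, cornerAngle T Φ i j k g - 2 * Real.pi) / (4 * Real.pi)) ?_
    fun g hg => funext fun i => flowField_eq hΦ (hpos g hg) i
  refine contDiffOn_pi.2 fun i => ContDiffOn.div_const (ContDiffOn.sub (contDiffOn_const.mul
    (ContDiffOn.sum fun j _ => ContDiffOn.sum fun k _ => fun g hg => ?_)) contDiffOn_const) _
  unfold cornerAngle
  split_ifs with h
  · obtain ⟨hp, hq, hw⟩ := hΦ.cos_mem_of_triangle h
    have h1 : ∀ l, ContDiffAt ℝ 1 (fun g : V → ℝ => radius (g l)) g := fun l =>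
      ContDiffAt.comp (g := radius) g (contDiffAt_radius (hpos g hg l)) (contDiffAt_apply ℝ ℝ l g)
    have h2 : ∀ l, 0 < radius (g l) := fun l => radius_pos (hpos g hg l)
    exact (contDiffAt_angle hp hq hw (h1 i) (h1 j) (h1 k) (h2 i) (h2 j) (h2 k)).contDiffWithinAt
  · exact contDiffWithinAt_const

/-- If `g i` is large, then all the angles at `i` are so small that they add up to at most `2π`. -/
theorem exists_forall_flowField_nonpos {T : Triangulation V X} {Φ : Finset V → ℝ}
    (hΦ : IsWeight T Φ) : ∃ B : ℝ, ∀ g : V → ℝ, (∀ i, 0 < g i) → ∀ i, B ≤ g i →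
      flowField T Φ g i ≤ 0 := by
  classical
  have hn : (0 : ℝ) < (Fintype.card V : ℝ) ^ 2 + 1 := by positivity
  -- The double sum over `j` and `k` has `(card V) ^ 2` terms and counts each triangle twice.
  have hε : 0 < 4 * Real.pi / ((Fintype.card V : ℝ) ^ 2 + 1) := by positivity
  obtain ⟨B, hB⟩ := exists_forall_angle_le hε
  refine ⟨B, fun g hg i hi => ?_⟩
  rw [flowField_eq hΦ hg]
  refine div_nonpos_of_nonpos_of_nonneg ?_ (by positivity)
  have h1 : ∀ j k, cornerAngle T Φ i j k g ≤ 4 * Real.pi / ((Fintype.card V : ℝ) ^ 2 + 1) := by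
    intro j k
    unfold cornerAngle
    split_ifs with h
    · obtain ⟨hp, hq, hw⟩ := hΦ.cos_mem_of_triangle h
      exact hB _ _ _ _ _ _ hp.1 hq.1 hw.2 (radius_pos (hg i)) (radius_pos (hg j))
        (radius_pos (hg k)) (by rwa [sinh_half_radius_sq (hg i).le])
    · exact hε.le
  have h2 : ∑ j, ∑ k, cornerAngle T Φ i j k g ≤
      ∑ _j : V, ∑ _k : V, 4 * Real.pi / ((Fintype.card V : ℝ) ^ 2 + 1) :=
    Finset.sum_le_sum fun j _ => Finset.sum_le_sum fun k _ => h1 j k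
  have h3 : ∑ _j : V, ∑ _k : V, 4 * Real.pi / ((Fintype.card V : ℝ) ^ 2 + 1) ≤ 4 * Real.pi := by
    simp only [Finset.sum_const, Finset.card_univ, nsmul_eq_mul]
    rw [← mul_assoc, ← mul_div_assoc, div_le_iff₀ hn]
    nlinarith [Real.pi_pos]
  linarith

theorem eventually_mul_le_of_hasDerivAt {f : ℝ → ℝ} {m c : ℝ} (hf : HasDerivAt f m 0)
    (h0 : f 0 = 0) (hc : c < m) : ∀ᶠ s in 𝓝[≥] (0 : ℝ), c * s ≤ f s := by
  have h1 : ∀ᶠ s in 𝓝[≠] (0 : ℝ), c < slope f 0 s :=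
    (hasDerivAt_iff_tendsto_slope.1 hf).eventually_const_lt hc
  rw [eventually_nhdsWithin_iff] at h1 ⊢
  filter_upwards [h1] with s hs hs0
  rcases (mem_Ici.1 hs0).eq_or_lt with rfl | hs0
  · simp [h0]
  · have h2 := hs hs0.ne'
    rw [slope_def_field, h0, sub_zero, sub_zero, lt_div_iff₀ hs0] at h2
    exact h2.le

/-- At an equilibrium every vertex lies in a triangle, so that all components of the flow field grow
linearly when all `tanh (r / 2)` are scaled down. -/
theorem exists_mul_le_flowField_sub_smul {T : Triangulation V X} {Φ : Finset V → ℝ}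
    (hΦ : IsWeight T Φ) {g : V → ℝ} (hg : ∀ i, 0 < g i) (hz : flowField T Φ g = 0) :
    ∃ d : V → ℝ, (∀ i, 0 < d i) ∧ ∃ c > 0, ∃ δ > 0, ∀ s ∈ Icc (0 : ℝ) δ, ∀ i,
      c * s ≤ flowField T Φ (g - s • d) i := by
  classical
  set d : V → ℝ := fun i => 2 * g i * (1 + g i) with hd
  have hd0 : ∀ i, 0 < d i := fun i => by
    have := hg i
    simp only [hd]; positivity
  have hcorner : ∀ i j k, ∃ m : ℝ, 0 ≤ m ∧ (({i, j, k} : Finset V) ∈ T.triangles → 0 < m) ∧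
      HasDerivAt (fun s : ℝ => cornerAngle T Φ i j k (g - s • d)) m 0 := by
    intro i j k
    unfold cornerAngle
    split_ifs with h
    · obtain ⟨hp, hq, hw⟩ := hΦ.cos_mem_of_triangle h
      have h1 : ∀ l, HasDerivAt (fun s : ℝ => radius ((g - s • d) l))
          (-Real.sinh (radius ((g - (0 : ℝ) • d) l))) 0 := fun l => by
        simpa using hasDerivAt_radius_sub_mul (hg l)
      have h2 : ∀ l, 0 < radius ((g - (0 : ℝ) • d) l) := fun l => by
        simpa using radius_pos (hg l)
      obtain ⟨m, hm, hm'⟩ :=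
        exists_hasDerivAt_angle_pos (X := fun s => radius ((g - s • d) i))
          (Y := fun s => radius ((g - s • d) j)) (Z := fun s => radius ((g - s • d) k)) hp hq hw
          (h2 i) (h2 j) (h2 k) (h1 i) (h1 j) (h1 k)
      exact ⟨m, hm.le, fun _ => hm, hm'⟩
    · exact ⟨0, le_rfl, fun h' => absurd h' h, hasDerivAt_const _ _⟩
  choose m hm0 hmpos hm using hcorner
  have hg' : ∀ᶠ s in 𝓝 (0 : ℝ), ∀ i, 0 < (g - s • d) i := by
    refine eventually_all.2 fun i => ?_
    have h1 : Tendsto (fun s : ℝ => g i - s * d i) (𝓝 0) (𝓝 (g i - 0 * d i)) :=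
      tendsto_const_nhds.sub (tendsto_id.mul_const (d i))
    exact h1.eventually_const_lt (by simpa using hg i)
  have hderiv : ∀ i, HasDerivAt (fun s : ℝ => flowField T Φ (g - s • d) i)
      (1 / 2 * ∑ j, ∑ k, m i j k / (4 * Real.pi)) 0 := by
    intro i
    have h1 : HasDerivAt (fun s : ℝ => (1 / 2 * ∑ j, ∑ k, cornerAngle T Φ i j k (g - s • d)
        - 2 * Real.pi) / (4 * Real.pi)) (1 / 2 * (∑ j, ∑ k, m i j k) / (4 * Real.pi)) 0 :=
      (((HasDerivAt.fun_sum fun j _ => HasDerivAt.fun_sum fun k _ => hm i j k).const_mul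
        (1 / 2)).sub_const _).div_const _
    refine (h1.congr_of_eventuallyEq ?_).congr_deriv ?_
    · filter_upwards [hg'] with s hs
      exact flowField_eq hΦ hs i
    · simp only [← Finset.sum_div, mul_div_assoc]
  have hpos : ∀ i, 0 < 1 / 2 * ∑ j, ∑ k, m i j k / (4 * Real.pi) := by
    intro i
    have h1 : ∃ j k, ({i, j, k} : Finset V) ∈ T.triangles := by
      by_contra! h
      have h2 := congrFun hz i
      have h3 : ∀ j k, cornerAngle T Φ i j k g = 0 := fun j k => if_neg (h j k)
      rw [flowField_eq hΦ hg] at h2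
      simp [h3, Real.pi_ne_zero] at h2
    obtain ⟨j, k, hjk⟩ := h1
    have h0 : ∀ j k, 0 ≤ m i j k / (4 * Real.pi) := fun j k =>
      div_nonneg (hm0 i j k) (by positivity)
    refine mul_pos one_half_pos ?_
    refine Finset.sum_pos' (fun j _ => Finset.sum_nonneg fun k _ => h0 j k)
      ⟨j, Finset.mem_univ j, Finset.sum_pos' (fun k _ => h0 j k) ⟨k, Finset.mem_univ k, ?_⟩⟩
    exact div_pos (hmpos i j k hjk) (by positivity)
  obtain ⟨c, hc, hcm⟩ : ∃ c : ℝ, 0 < c ∧ ∀ i, c < 1 / 2 * ∑ j, ∑ k, m i j k / (4 * Real.pi) := by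
    have h1 : ∀ᶠ c in 𝓝[>] (0 : ℝ), 0 < c := self_mem_nhdsWithin
    have h2 : ∀ᶠ c in 𝓝[>] (0 : ℝ), ∀ i, c < 1 / 2 * ∑ j, ∑ k, m i j k / (4 * Real.pi) :=
      eventually_all.2 fun i => nhdsWithin_le_nhds (Iio_mem_nhds (hpos i))
    exact (h1.and h2).exists
  have hev : ∀ᶠ s in 𝓝[≥] (0 : ℝ), ∀ i, c * s ≤ flowField T Φ (g - s • d) i :=
    eventually_all.2 fun i => eventually_mul_le_of_hasDerivAt (hderiv i)
      (by simpa using congrFun hz i) (hcm i)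
  obtain ⟨δ, hδ, h⟩ := mem_nhdsGE_iff_exists_Icc_subset.1 hev
  exact ⟨d, hd0, c, hc, δ, hδ, fun s hs => h hs⟩

theorem neg_curvature_mul_sinh_sq (T : Triangulation V X) (Φ : Finset V → ℝ) {r : V → ℝ}
    (hr : IsMetric r) (i : V) : -(curvature T Φ r i) * Real.sinh (r i / 2) ^ 2 =
      flowField T Φ (fun j => Real.sinh (r j / 2) ^ 2) i := by
  have h1 : Real.sinh (r i / 2) ≠ 0 := (Real.sinh_pos_iff.2 (half_pos (hr i))).ne'
  have h2 : (fun j => radius (Real.sinh (r j / 2) ^ 2)) = r :=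
    funext fun j => radius_sinh_half_sq (hr j).le
  rw [flowField, h2, curvature]
  field_simp

theorem IsRicciFlow.hasDerivWithinAt {T : Triangulation V X} {Φ : Finset V → ℝ} {r₀ : V → ℝ}
    {J : Set ℝ} {r : ℝ → V → ℝ} (h : IsRicciFlow T Φ r₀ J r) {t : ℝ} (ht : t ∈ J) :
    HasDerivWithinAt (fun s i => Real.sinh (r s i / 2) ^ 2)
      (flowField T Φ fun i => Real.sinh (r t i / 2) ^ 2) J t :=
  hasDerivWithinAt_pi.2 fun i =>
    ((h.2 t ht).2 i).congr_deriv (neg_curvature_mul_sinh_sq T Φ (h.2 t ht).1 i)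

theorem isRicciFlow_radius {T : Triangulation V X} {Φ : Finset V → ℝ} {r₀ : V → ℝ} {J : Set ℝ}
    {g : ℝ → V → ℝ} (hr₀ : IsMetric r₀) (h0 : g 0 = fun i => Real.sinh (r₀ i / 2) ^ 2)
    (hpos : ∀ t ∈ J, ∀ i, 0 < g t i)
    (hg : ∀ t ∈ J, HasDerivWithinAt g (flowField T Φ (g t)) J t) :
    IsRicciFlow T Φ r₀ J fun t i => radius (g t i) := by
  refine ⟨funext fun i => ?_, fun t ht => ?_⟩
  · simp only [h0]; exact radius_sinh_half_sq (hr₀ i).le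
  have hm : IsMetric fun i => radius (g t i) := fun i => radius_pos (hpos t ht i)
  refine ⟨hm, fun i => ?_⟩
  have h1 : ∀ s ∈ J, ∀ i, Real.sinh (radius (g s i) / 2) ^ 2 = g s i := fun s hs i =>
    sinh_half_radius_sq (hpos s hs i).le
  rw [neg_curvature_mul_sinh_sq T Φ hm, funext (h1 t ht)]
  exact (hasDerivWithinAt_pi.1 (hg t ht) i).congr (fun s hs => h1 s hs i) (h1 t ht i)

/-- Two solutions of the flow with the same initial metric agree on their common interval of
existence. -/
theorem IsRicciFlow.eqOn_Ico {T : Triangulation V X} {Φ : Finset V → ℝ} (hΦ : IsWeight T Φ)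
    {r₀ : V → ℝ} {r r' : ℝ → V → ℝ} {τ : ℝ} (hr' : IsRicciFlow T Φ r₀ (Ico 0 τ) r')
    (hr : IsRicciFlow T Φ r₀ (Ici 0) r) : EqOn r' r (Ico 0 τ) := by
  intro t ht
  have hsub : Icc 0 t ⊆ Ico 0 τ := Icc_subset_Ico_right ht.2
  have hsub' : Icc 0 t ⊆ Ici 0 := Icc_subset_Ici_self
  have h := eqOn_of_hasDerivWithinAt_of_pos (exists_lipschitzOnWith_flowField hΦ)
    (fun s hs => (hr'.hasDerivWithinAt (hsub hs)).mono hsub)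
    (fun s hs => (hr.hasDerivWithinAt (hsub' hs)).mono hsub')
    (fun s hs => sinh_half_sq_pos (hr'.2 s (hsub hs)).1)
    (fun s hs => sinh_half_sq_pos (hr.2 s (hsub' hs)).1)
    (by simp only [hr.1, hr'.1]) (right_mem_Icc.2 ht.1)
  funext i
  rw [← radius_sinh_half_sq ((hr'.2 t ht).1 i).le, ← radius_sinh_half_sq ((hr.2 t ht.1).1 i).le]
  exact congrArg radius (congrFun h i)

theorem exists_lipschitzOnWith_radius (lo hi : V → ℝ) (hlo : ∀ i, 0 < lo i) :
    ∃ K, LipschitzOnWith K (fun (g : V → ℝ) i => radius (g i)) (Icc lo hi) := by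
  refine ContDiffOn.exists_lipschitzOnWith (n := 1) ?_ one_ne_zero (convex_Icc lo hi) isCompact_Icc
  exact contDiffOn_pi.2 fun i g hg => (ContDiffAt.comp (g := radius) g
    (contDiffAt_radius ((hlo i).trans_le (hg.1 i))) (contDiffAt_apply ℝ ℝ i g)).contDiffWithinAt

end CirclePacking

theorem mainTheorem2
    {X : Type*} [TopologicalSpace X] [T2Space X] [CompactSpace X]
    [ChartedSpace (EuclideanSpace ℝ (Fin 2)) X]
    {V : Type*} [Fintype V]
    (T : CirclePacking.Triangulation V X)
    (Φ : Finset V → ℝ) (hΦ : CirclePacking.IsWeight T Φ)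
    (r₀ : V → ℝ) (hr₀ : CirclePacking.IsMetric r₀)
    (hR : ∀ i, CirclePacking.curvature T Φ r₀ i ≤ 0) :
    ∃ rstar : V → ℝ, CirclePacking.IsZeroCurvatureMetric T Φ rstar ∧
      ∃ r : ℝ → V → ℝ,
        CirclePacking.IsRicciFlow T Φ r₀ (Set.Ici 0) r ∧
        (∀ (τ : ℝ) (r' : ℝ → V → ℝ), CirclePacking.IsRicciFlow T Φ r₀ (Set.Ico 0 τ) r' →
          Set.EqOn r' r (Set.Ico 0 τ)) ∧
        ∃ C c : ℝ, 0 < c ∧ ∀ t : ℝ, 0 ≤ t → ‖r t - rstar‖ ≤ C * Real.exp (-c * t) := by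
  open CirclePacking in
  set g₀ : V → ℝ := fun i => Real.sinh (r₀ i / 2) ^ 2 with hg₀
  have hg₀pos : ∀ i, 0 < g₀ i := sinh_half_sq_pos hr₀
  have hF₀ : 0 ≤ flowField T Φ g₀ := fun i => by
    rw [← neg_curvature_mul_sinh_sq T Φ hr₀]
    exact mul_nonneg (neg_nonneg.2 (hR i)) (sq_nonneg _)
  obtain ⟨B, hB⟩ := exists_forall_flowField_nonpos hΦ
  obtain ⟨y, hy, hg₀y, g, hg0, hg, C, c, hc, hC⟩ :=
    (quasimonotoneOn_flowField hΦ).exists_solution_tendsto_exponentially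
      (exists_lipschitzOnWith_flowField hΦ) hB hg₀pos hF₀
      (fun y hy hz => exists_mul_le_flowField_sub_smul hΦ hy hz)
  have hypos : ∀ i, 0 < y i := fun i => (hg₀pos i).trans_le (hg₀y i)
  have hgpos : ∀ t ∈ Set.Ici (0 : ℝ), ∀ i, 0 < g t i := fun t ht i =>
    (hg₀pos i).trans_le ((hg t ht).2.1 i)
  have hflow := isRicciFlow_radius (T := T) (Φ := Φ) hr₀ hg0 hgpos fun t ht => (hg t ht).1
  have hmetric : IsMetric fun i => radius (y i) := fun i => radius_pos (hypos i)
  obtain ⟨K, hK⟩ := exists_lipschitzOnWith_radius g₀ y hg₀pos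
  refine ⟨fun i => radius (y i), ⟨hmetric, fun i => ?_⟩, fun t i => radius (g t i), hflow,
    fun τ r' hr' => hr'.eqOn_Ico hΦ hflow, K * C, c, hc, fun t ht => ?_⟩
  · have h1 := neg_curvature_mul_sinh_sq T Φ hmetric i
    have h2 : (fun i => Real.sinh (radius (y i) / 2) ^ 2) = y :=
      funext fun i => sinh_half_radius_sq (hypos i).le
    rw [h2, hy, Pi.zero_apply, mul_eq_zero, neg_eq_zero] at h1
    exact h1.resolve_right (sinh_half_sq_pos hmetric i).ne'
  · have h1 := hK.dist_le_mul _ (hg t ht).2 _ ⟨hg₀y, le_rfl⟩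
    rw [dist_eq_norm, dist_eq_norm] at h1
    calc _ ≤ K * ‖g t - y‖ := h1
      _ ≤ K * (C * Real.exp (-c * t)) := mul_le_mul_of_nonneg_left (hC t ht) K.2
      _ = K * C * Real.exp (-c * t) := by ring
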